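/- Let $\mathfrak T$ be a triangulation of a compact surface without boundary, with finite vertex set $V$, edge set $E$ and face set $F$: a finite two-dimensional simplicial complex in which every edge lies in exactly two faces and every vertex link is connected. Write $\|\mathfrak T\|$ for its total space and $\|c\|\subset\|\mathfrak T\|$ for the closed cell of $c\in V\cup E\cup F$. A geodesic triangulation of type $\mathfrak T$ is a compact hyperbolic surface $G$ without boundary together with a homeomorphism $f:\|\mathfrak T\|\to G$ such that, for every face $t$, a neighbourhood of $f(\|t\|)$ embeds isometrically in the hyperbolic plane $H^2$ so that $f(\|t\|)$ is taken to a nondegenerate geodesic triangle, whose vertices and sides are the images of the vertices and edges of $t$. For an edge $e$ of a face $t$ embedded in this way, let $\gamma^e$ be the geodesic of $H^2$ containing the image of $e$, and let $\theta^e_t$ be the angle between $\gamma^e$ and the boundary of the circumscribing disk of $t$ (the curve cut out in the Poincaré disk by the Euclidean circle through the three vertices of $t$), measured on the side of $\gamma^e$ containing $t$ and outside of the circumscribing disk, that is, between the tangent of the circle pointing to this side and the prolongation of $e$. (If $A$ is the inner angle of $t$ opposite to $e$ and $B,C$ are the other two, then $\theta^e_t=\frac{\pi+A-B-C}{2}$.)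 The intersection angle at an edge $e$ shared by the faces $t_1\neq t_2$ is $\theta^e_{t_1}+\theta^e_{t_2}$. A vector $p=(p_e)_{e\in E}\in\mathbb R^{|E|}$ is realized by a geodesic triangulation if $\pi-p_e$ is its intersection angle at $e$ for every $e\in E$. Then a realization of $p$ is unique: if $p\in\mathbb R^{|E|}$ is realized by the geodesic triangulations $(G,f)$ and $(G',f')$ of type $\mathfrak T$, then there is an isometry $i:G\to G'$ with $i(f(\|c\|))=f'(\|c\|)$ for every vertex, edge and face $c$ of $\mathfrak T$. -/

import Mathlib

/-! ### Hyperbolic surfaces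

The hyperbolic plane is `UpperHalfPlane` with its metric of curvature `-1`.  A hyperbolic surface
is a space with an atlas of charts in the hyperbolic plane whose transition maps are locally
restrictions of isometries of the hyperbolic plane. -/

/-- The map `f` agrees near every point of `s` with an isometry of the hyperbolic plane. -/
def IsLocallyHypIsometry (f : UpperHalfPlane → UpperHalfPlane) (s : Set UpperHalfPlane) : Prop :=
  ∀ x ∈ s, ∃ U : Set UpperHalfPlane, IsOpen U ∧ x ∈ U ∧
    ∃ g : UpperHalfPlane ≃ᵢ UpperHalfPlane, Set.EqOn f g (s ∩ U)

/-- Local isometries of the hyperbolic plane, as a pregroupoid. -/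
noncomputable def hypPregroupoid : Pregroupoid UpperHalfPlane where
  property := IsLocallyHypIsometry
  comp := by
    intro f g u v hf hg _ _ _ x hx
    obtain ⟨U, hU, hxU, a, ha⟩ := hf x hx.1
    obtain ⟨W, hW, hxW, b, hb⟩ := hg (f x) hx.2
    have hfa : f x = a x := ha ⟨hx.1, hxU⟩
    refine ⟨U ∩ a ⁻¹' W, hU.inter (hW.preimage a.continuous), ⟨hxU, ?_⟩, a.trans b, ?_⟩
    · rw [Set.mem_preimage, ← hfa]; exact hxW
    · rintro y ⟨⟨hyu, hyv⟩, hyU, hyW⟩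
      have hy : f y = a y := ha ⟨hyu, hyU⟩
      have h2 : g (f y) = b (f y) := hb ⟨hyv, by rw [hy]; exact hyW⟩
      simp only [Function.comp_apply, IsometryEquiv.trans_apply, h2]; rw [hy]
  id_mem := fun x _ => ⟨Set.univ, isOpen_univ, Set.mem_univ x, IsometryEquiv.refl _, fun _ _ => rfl⟩
  locality := by
    intro f u _ h x hx
    obtain ⟨v, hv, hxv, hf⟩ := h x hx
    obtain ⟨U, hU, hxU, g, hg⟩ := hf x ⟨hx, hxv⟩
    exact ⟨v ∩ U, hv.inter hU, ⟨hxv, hxU⟩, g, fun y hy => hg ⟨⟨hy.1, hy.2.1⟩, hy.2.2⟩⟩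
  congr := by
    intro f g u _ hfg hf x hx
    obtain ⟨U, hU, hxU, a, ha⟩ := hf x hx
    exact ⟨U, hU, hxU, a, fun y hy => (hfg y hy.1).trans (ha hy)⟩

/-- The groupoid of local isometries of the hyperbolic plane.  A hyperbolic surface is a space
charted on the hyperbolic plane which has this groupoid; an isometry between two hyperbolic
surfaces is a structomorphism for it. -/
noncomputable def hypGroupoid : StructureGroupoid UpperHalfPlane :=
  hypPregroupoid.groupoid

/-! ### Hyperbolic segments, triangles and circumscribing circles -/

/-- The geodesic segment between two points of the hyperbolic plane. -/
def hypSegment (a b : UpperHalfPlane) : Set UpperHalfPlane :=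
  {z | dist a z + dist z b = dist a b}

/-- The closed geodesic triangle (convex hull) with vertices `a`, `b`, `c`: the union of the
geodesic segments from `a` to the points of the side opposite to `a`. -/
def hypTriangle (a b c : UpperHalfPlane) : Set UpperHalfPlane :=
  ⋃ z ∈ hypSegment b c, hypSegment a z

/-- The coordinate of `z` in the Poincaré disk model of the hyperbolic plane whose centre is `a`.
It is a conformal isometry onto the Poincaré disk, taking `a` to `0`, so that geodesics
through `a` become Euclidean diameters. -/
noncomputable def poincareDisk (a z : UpperHalfPlane) : ℂ :=
  ((z : ℂ) - (a : ℂ)) / ((z : ℂ) - (starRingEnd ℂ) (a : ℂ))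

/-- For nonzero `u`, a number which is positive on one side of the Euclidean line through `0` and
`u`, and negative on the other side. -/
def lineSide (u z : ℂ) : ℝ :=
  ((starRingEnd ℂ) u * z).im

/-- `θ` is the angle, at the vertex `a` of the geodesic triangle `a b c`, between the boundary of
the circumscribing disk and the geodesic through `a` and `b`, measured on the side of this
geodesic which contains the triangle.

The triangle is placed in the Poincaré disk with `a` at the centre.  Its circumscribing circle is
the Euclidean circle through the three vertices, with centre `o`; `τ` is the tangent vector at `a`
to this circle that points to the side of the geodesic containing `c`.  Measured on this side, the
angle is the one outside of the disk, between `τ` and the prolongation of the edge `b a` beyond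
`a`.  In terms of the inner angles `α`, `β`, `γ` of the triangle at `a`, `b`, `c`, it is
`(π + γ - α - β) / 2`. -/
def IsCircumscribedAngle (a b c : UpperHalfPlane) (θ : ℝ) : Prop :=
  ∃ o τ : ℂ,
    ‖poincareDisk a b - o‖ = ‖o‖ ∧ ‖poincareDisk a c - o‖ = ‖o‖ ∧
    τ ≠ 0 ∧ inner ℝ τ o = 0 ∧
    0 < lineSide (poincareDisk a b) τ * lineSide (poincareDisk a b) (poincareDisk a c) ∧
    θ = InnerProductGeometry.angle τ (-poincareDisk a b)

/-! ### Triangulations of closed surfaces -/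

/-- A triangulation of a compact surface without boundary, with vertex set `V`: a finite
two-dimensional simplicial complex, given by its faces, such that every edge lies in exactly two
faces and the link of every vertex is connected (hence a single cycle). -/
structure SurfaceTriangulation (V : Type*) where
  faces : Finset (Finset V)
  card_face : ∀ t ∈ faces, t.card = 3
  vertex_mem_face : ∀ v : V, ∃ t ∈ faces, v ∈ t
  edge_two_faces : ∀ t ∈ faces, ∀ e ⊆ t, e.card = 2 → {s | s ∈ faces ∧ e ⊆ s}.ncard = 2
  link_connected : ∀ v : V, ∀ t ∈ faces, v ∈ t → ∀ t' ∈ faces, v ∈ t' →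
    Relation.ReflTransGen
      (fun s s' => s' ∈ faces ∧ ∃ e : Finset V, e.card = 2 ∧ v ∈ e ∧ e ⊆ s ∧ e ⊆ s') t t'

namespace SurfaceTriangulation

variable {V : Type*} [Fintype V]

/-- The edges of a triangulation: the two-element subsets of its faces. -/
def Edge (T : SurfaceTriangulation V) : Type _ :=
  {e : Finset V // e.card = 2 ∧ ∃ t ∈ T.faces, e ⊆ t}

/-- The total space of a triangulation: its geometric realization in barycentric coordinates. -/
def totalSpace (T : SurfaceTriangulation V) : Set (V → ℝ) :=
  {w | w ∈ stdSimplex ℝ V ∧ ∃ t ∈ T.faces, ∀ v, w v ≠ 0 → v ∈ t}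

/-- The closed cell of the total space spanned by a set of vertices. -/
def cell (T : SurfaceTriangulation V) (s : Finset V) : Set T.totalSpace :=
  {w | ∀ v, w.1 v ≠ 0 → v ∈ s}

variable {G : Type*} [TopologicalSpace G] [ChartedSpace UpperHalfPlane G]

/-- An isometric embedding `φ` of a neighbourhood of the face `t` of a triangulated hyperbolic
surface in the hyperbolic plane, taking `t` to the nondegenerate geodesic triangle with vertices
`x v`, where `v` runs through the vertices of `t` (the other values of `x` are irrelevant), and
taking the vertices and edges of `t` to the vertices and sides of the triangle. -/
structure IsFaceEmbedding (T : SurfaceTriangulation V) (f : T.totalSpace ≃ₜ G) (t : Finset V)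
    (φ : OpenPartialHomeomorph G UpperHalfPlane) (x : V → UpperHalfPlane) : Prop where
  mem_maximalAtlas : φ ∈ hypGroupoid.maximalAtlas G
  subset_source : f '' T.cell t ⊆ φ.source
  image_vertex : ∀ a ∈ t, φ '' (f '' T.cell {a}) = {x a}
  image_edge : ∀ e ⊆ t, e.card = 2 → ∀ a ∈ e, ∀ b ∈ e, a ≠ b →
    φ '' (f '' T.cell e) = hypSegment (x a) (x b)
  image_face : ∀ a ∈ t, ∀ b ∈ t, ∀ c ∈ t, a ≠ b → b ≠ c → c ≠ a →
    φ '' (f '' T.cell t) = hypTriangle (x a) (x b) (x c)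
  nondegenerate : ∀ a ∈ t, ∀ b ∈ t, ∀ c ∈ t, a ≠ b → b ≠ c → c ≠ a →
    x a ∉ hypSegment (x b) (x c)

/-- The homeomorphism `f` from the total space of `T` to the hyperbolic surface `G` is a geodesic
triangulation of `G`: every face embeds in the hyperbolic plane as a geodesic triangle. -/
def IsGeodesic (T : SurfaceTriangulation V) (f : T.totalSpace ≃ₜ G) : Prop :=
  ∀ t ∈ T.faces, ∃ φ x, T.IsFaceEmbedding f t φ x

/-- `θ` is the angle between the boundary of the circumscribing disk of the face `t` and the
geodesic containing the edge `e` of `t`, on the side of `t`, in a geodesic triangulation. -/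
def IsFaceAngle (T : SurfaceTriangulation V) (f : T.totalSpace ≃ₜ G) (t e : Finset V)
    (θ : ℝ) : Prop :=
  ∃ φ x, T.IsFaceEmbedding f t φ x ∧
    ∃ a ∈ e, ∃ b ∈ e, a ≠ b ∧ ∃ c ∈ t, c ∉ e ∧ IsCircumscribedAngle (x a) (x b) (x c) θ

/-- The vector `p` is realized by the geodesic triangulation `f` of `G`: at every edge the
intersection angle of the circumscribing disks of the two adjacent faces is `π - p e`. -/
def IsRealizedBy (T : SurfaceTriangulation V) (p : T.Edge → ℝ) (f : T.totalSpace ≃ₜ G) : Prop :=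
  T.IsGeodesic f ∧
    ∀ e : T.Edge, ∀ t₁ ∈ T.faces, ∀ t₂ ∈ T.faces, t₁ ≠ t₂ → e.1 ⊆ t₁ → e.1 ⊆ t₂ →
      ∃ θ₁ θ₂ : ℝ, T.IsFaceAngle f t₁ e.1 θ₁ ∧ T.IsFaceAngle f t₂ e.1 θ₂ ∧
        Real.pi - p e = θ₁ + θ₂

end SurfaceTriangulation

/-! The argument is variational. In a hyperbolic triangle with angles `A`, `B`, `C`, the complement
`π / 2 - θ` of the circumscribing angle at the side opposite to `A` is `(B + C - A) / 2`. The
complements `p`, `q`, `r` range over a convex set (`IsAngleTriple`): their pairwise sums are the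
inner angles and their total is half of the angle sum. By the dual law of cosines, `sinh ^ 2` of
half a side is `cos (p + q + r) * cos p / (sin (p + q) * sin (p + r))` (`IsSideTriple.two_mul_log`).
The logarithms of these three quantities form the gradient of a function of `(p, q, r)` whose
Hessian is negative definite (`angle_hessian_pos`). Hence, for two noncongruent triangles, the sum
over the sides of the change of log length times the change of circumscribing angle is positive
(`IsSideTriple.pairing_pos`).

This sum is now added up over all faces of two realizations. The two faces at an edge share its
length, and their angles there add up to `π - p e` in both realizations, so the contributions of
each edge cancel and the total is zero. Since no face contributes a negative amount, every face
contributes zero, and corresponding faces have equal sides (`IsRealizedBy.dist_eq`).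

It remains to glue. Each pair of corresponding faces is matched by an isometry of the plane
(`exists_isometryEquiv_of_dist_eq`). Across an edge two such isometries agree, because in both
surfaces adjacent faces lie on opposite sides of their edge (`IsFaceEmbedding.not_hypSide_mul_pos`);
at a vertex they agree by going around its link. The glued map is a homeomorphism and locally an
isometry (`structomorphOfIsSurfaceIsometryAt`). -/

/-! ### Concavity of the angle potential of one triangle. -/

open Real in
theorem tan_add_cot_quadratic_pos {p q : ℝ} (hp : 0 < cos p) (hq : 0 < cos q)
    (hpq : 0 < sin (p + q)) (d e : ℝ) :
    0 ≤ sin p / cos p * d ^ 2 + sin q / cos q * e ^ 2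
      + cos (p + q) / sin (p + q) * (d + e) ^ 2 ∧
    (d + e ≠ 0 → 0 < sin p / cos p * d ^ 2 + sin q / cos q * e ^ 2
      + cos (p + q) / sin (p + q) * (d + e) ^ 2) := by
  -- Over a common positive denominator the form is a sum of two squares, and the second square
  -- vanishes only for `d + e = 0`.
  have key : sin p / cos p * d ^ 2 + sin q / cos q * e ^ 2
      + cos (p + q) / sin (p + q) * (d + e) ^ 2
      = ((sin p * cos q * d - sin q * cos p * e) ^ 2 + (cos p * cos q * (d + e)) ^ 2)
        / (cos p * cos q * sin (p + q)) := by
    have h1 := hp.ne'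
    have h2 := hq.ne'
    have h3 := hpq.ne'
    rw [sin_add] at h3
    rw [cos_add, sin_add]
    field_simp
    ring
  rw [key]
  refine ⟨by positivity, fun h => div_pos ?_ (by positivity)⟩
  have : cos p * cos q * (d + e) ≠ 0 := by positivity
  positivity

open Real in
/-- The Hessian of the angle potential of a hyperbolic triangle is definite. -/
theorem angle_hessian_pos {p q r : ℝ} (hp : 0 < cos p) (hq : 0 < cos q) (hr : 0 < cos r)
    (hS : 0 < cos (p + q + r)) (hpq : 0 < sin (p + q)) (hqr : 0 < sin (q + r))
    (hpr : 0 < sin (p + r)) {d e f : ℝ} (h : ¬ (d = 0 ∧ e = 0 ∧ f = 0)) :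
    0 < sin (p + q + r) / cos (p + q + r) * (d + e + f) ^ 2
      + (sin p / cos p * d ^ 2 + sin q / cos q * e ^ 2 + sin r / cos r * f ^ 2)
      + (cos (p + q) / sin (p + q) * (d + e) ^ 2 + cos (q + r) / sin (q + r) * (e + f) ^ 2
        + cos (p + r) / sin (p + r) * (d + f) ^ 2) := by
  have aux : ∀ x : ℝ, 0 < cos x → 0 < cos (-x) := fun x hx => by rwa [cos_neg]
  have e1 : p + q + r + -p = q + r := by ring
  have e2 : p + q + r + -q = p + r := by ring
  have e3 : p + q + r + -r = p + q := by ring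
  have f1 : d + e + f + -d = e + f := by ring
  have f2 : d + e + f + -e = d + f := by ring
  have f3 : d + e + f + -f = d + e := by ring
  -- The form is two thirds of the sum of the three `a` forms plus one third of the sum of the three
  -- `c` forms. The latter pair the total `p + q + r` with the negative of one variable, so that
  -- their cotangent terms are again those of the pairwise sums. Strictness comes from the `a`
  -- forms: the three pairwise sums of `d`, `e`, `f` cannot all vanish.
  obtain ⟨a1, b1⟩ := tan_add_cot_quadratic_pos hp hq hpq d e
  obtain ⟨a2, b2⟩ := tan_add_cot_quadratic_pos hq hr hqr e f
  obtain ⟨a3, b3⟩ := tan_add_cot_quadratic_pos hp hr hpr d f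
  obtain ⟨c1, -⟩ := tan_add_cot_quadratic_pos hS (aux p hp) (by rwa [e1]) (d + e + f) (-d)
  obtain ⟨c2, -⟩ := tan_add_cot_quadratic_pos hS (aux q hq) (by rwa [e2]) (d + e + f) (-e)
  obtain ⟨c3, -⟩ := tan_add_cot_quadratic_pos hS (aux r hr) (by rwa [e3]) (d + e + f) (-f)
  rw [e1, f1, sin_neg, cos_neg] at c1
  rw [e2, f2, sin_neg, cos_neg] at c2
  rw [e3, f3, sin_neg, cos_neg] at c3
  rw [neg_sq, neg_div] at c1 c2 c3
  by_cases h1 : d + e ≠ 0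
  · have := b1 h1; linarith
  by_cases h2 : e + f ≠ 0
  · have := b2 h2; linarith
  by_cases h3 : d + f ≠ 0
  · have := b3 h3; linarith
  push Not at h1 h2 h3
  exact absurd ⟨by linarith, by linarith, by linarith⟩ h

/-- The half differences of the angles of a hyperbolic triangle. -/
structure IsAngleTriple (p q r : ℝ) : Prop where
  lt_pi_div_two : p + q + r < Real.pi / 2
  pos_left : 0 < p + q
  pos_right : 0 < q + r
  pos_outer : 0 < p + r

namespace IsAngleTriple

variable {p q r : ℝ}

open Real

theorem cos_pos (h : IsAngleTriple p q r) :
    0 < cos p ∧ 0 < cos q ∧ 0 < cos r ∧ 0 < cos (p + q + r) := by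
  obtain ⟨h1, h2, h3, h4⟩ := h
  refine ⟨?_, ?_, ?_, ?_⟩ <;> refine cos_pos_of_mem_Ioo ⟨?_, ?_⟩ <;> linarith

theorem sin_pos (h : IsAngleTriple p q r) :
    0 < sin (p + q) ∧ 0 < sin (q + r) ∧ 0 < sin (p + r) := by
  obtain ⟨h1, h2, h3, h4⟩ := h
  refine ⟨?_, ?_, ?_⟩ <;> refine sin_pos_of_pos_of_lt_pi ?_ ?_ <;> linarith

/-- Strict linear inequalities cut out a convex set. This keeps all logarithms in `angleForm`
differentiable along the segment between two triangles. -/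
theorem segment (h : IsAngleTriple p q r) {p' q' r' : ℝ} (h' : IsAngleTriple p' q' r') {t : ℝ}
    (ht0 : 0 ≤ t) (ht1 : t ≤ 1) :
    IsAngleTriple (p + t * (p' - p)) (q + t * (q' - q)) (r + t * (r' - r)) := by
  have aux : ∀ x x' : ℝ, 0 < x → 0 < x' → 0 < x + t * (x' - x) := by
    intro x x' hx hx'
    rcases eq_or_lt_of_le ht0 with rfl | h0
    · simpa
    · nlinarith [mul_pos h0 hx', mul_nonneg (sub_nonneg.2 ht1) hx.le]
  obtain ⟨h1, h2, h3, h4⟩ := h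
  obtain ⟨h1', h2', h3', h4'⟩ := h'
  have k1 := aux _ _ (sub_pos.2 h1) (sub_pos.2 h1')
  have k2 := aux _ _ h2 h2'
  have k3 := aux _ _ h3 h3'
  have k4 := aux _ _ h4 h4'
  constructor <;> linarith

end IsAngleTriple

open Real in
/-- The pairing of a variation `(d, e, f)` of the angles with the logarithmic edge lengths. -/
noncomputable def angleForm (d e f p q r : ℝ) : ℝ :=
  (d + e + f) * log (cos (p + q + r))
    + (d * log (cos p) + e * log (cos q) + f * log (cos r))
    - ((d + e) * log (sin (p + q)) + (e + f) * log (sin (q + r)) + (d + f) * log (sin (p + r)))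

open Real in
theorem IsAngleTriple.angleForm_lt {p q r p' q' r' : ℝ} (h : IsAngleTriple p q r)
    (h' : IsAngleTriple p' q' r') (hne : ¬ (p' = p ∧ q' = q ∧ r' = r)) :
    angleForm (p' - p) (q' - q) (r' - r) p' q' r' <
      angleForm (p' - p) (q' - q) (r' - r) p q r := by
  set d := p' - p with hd
  set e := q' - q with he
  set f := r' - r with hf
  have hder : ∀ t ∈ Set.Icc (0 : ℝ) 1, ∃ D < 0,
      HasDerivAt (fun t => angleForm d e f (p + t * d) (q + t * e) (r + t * f)) D t := by
    intro t ht
    have ht' := h.segment h' ht.1 ht.2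
    rw [← hd, ← he, ← hf] at ht'
    obtain ⟨c1, c2, c3, c4⟩ := ht'.cos_pos
    obtain ⟨s1, s2, s3⟩ := ht'.sin_pos
    have lin : ∀ x a : ℝ, HasDerivAt (fun t : ℝ => x + t * a) a t := fun x a => by
      simpa using ((hasDerivAt_id t).mul_const a).const_add x
    have hp := lin p d
    have hq := lin q e
    have hr := lin r f
    have hQ := angle_hessian_pos c1 c2 c3 c4 s1 s2 s3 (d := d) (e := e) (f := f) (by
      rintro ⟨a1, a2, a3⟩
      exact hne ⟨by linarith, by linarith, by linarith⟩)
    -- The derivative along the segment is minus the quadratic form of `angle_hessian_pos` in the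
    -- direction `(d, e, f)`.
    refine ⟨_, neg_lt_zero.2 hQ, ?_⟩
    have H := (((((hp.add hq).add hr).cos.log c4.ne').const_mul (d + e + f)).add
      ((((hp.cos.log c1.ne').const_mul d).add ((hq.cos.log c2.ne').const_mul e)).add
        ((hr.cos.log c3.ne').const_mul f))).sub
      (((((hp.add hq).sin.log s1.ne').const_mul (d + e)).add
        (((hq.add hr).sin.log s2.ne').const_mul (e + f))).add
        (((hp.add hr).sin.log s3.ne').const_mul (d + f)))
    refine HasDerivAt.congr_deriv (f := fun t => angleForm d e f (p + t * d) (q + t * e) (r + t * f))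
      H ?_
    simp only [Pi.add_apply]
    ring
  have hanti : StrictAntiOn (fun t => angleForm d e f (p + t * d) (q + t * e) (r + t * f))
      (Set.Icc 0 1) := by
    apply strictAntiOn_of_deriv_neg (convex_Icc 0 1)
    · intro t ht
      obtain ⟨D, -, hD⟩ := hder t ht
      exact hD.continuousAt.continuousWithinAt
    · intro t ht
      obtain ⟨D, h0, hD⟩ := hder t (interior_subset ht)
      rwa [hD.deriv]
  have := hanti (Set.left_mem_Icc.2 zero_le_one) (Set.right_mem_Icc.2 zero_le_one) zero_lt_one
  simpa [hd, he, hf] using this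

/-! ### Side lengths and circumscribing angles of one triangle. -/

/-- `sinh` of the half side lengths of a nondegenerate hyperbolic triangle. -/
structure IsSideTriple (X Y Z : ℝ) : Prop where
  pos_left : 0 < X
  pos_mid : 0 < Y
  pos_right : 0 < Z
  -- Heron's expression (16 times the squared area of a Euclidean triangle with sides `X`, `Y`, `Z`)
  -- plus a curvature term. It is symmetric in the three sides.
  disc_pos : 0 < 4 * Y ^ 2 * Z ^ 2 - (Y ^ 2 + Z ^ 2 - X ^ 2) ^ 2 + 4 * X ^ 2 * Y ^ 2 * Z ^ 2

/-- The angle between the side opposite to `Z` and the circumscribing circle. -/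
noncomputable def circumAngle (X Y Z : ℝ) : ℝ :=
  Real.arccos ((X ^ 2 + Y ^ 2 - Z ^ 2) / (2 * X * Y * Real.sqrt (1 + Z ^ 2)))

theorem circumAngle_swap (X Y Z : ℝ) : circumAngle X Y Z = circumAngle Y X Z := by
  unfold circumAngle
  rw [add_comm (X ^ 2), mul_assoc 2 X, mul_comm X, ← mul_assoc]

namespace IsSideTriple

variable {X Y Z : ℝ}

open Real

theorem rotate (h : IsSideTriple X Y Z) : IsSideTriple Y Z X := by
  obtain ⟨h1, h2, h3, h4⟩ := h
  exact ⟨h2, h3, h1, by linarith⟩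

/-- One minus the squared argument of `arccos` has the discriminant as numerator. This both confines
the argument to `[-1, 1]` and evaluates the sine. -/
theorem sin_cos_circumAngle (h : IsSideTriple X Y Z) :
    sin (π / 2 - circumAngle X Y Z) = (X ^ 2 + Y ^ 2 - Z ^ 2) / (2 * X * Y * √(1 + Z ^ 2)) ∧
    cos (π / 2 - circumAngle X Y Z) =
      √(4 * Y ^ 2 * Z ^ 2 - (Y ^ 2 + Z ^ 2 - X ^ 2) ^ 2 + 4 * X ^ 2 * Y ^ 2 * Z ^ 2)
        / (2 * X * Y * √(1 + Z ^ 2)) := by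
  obtain ⟨h1, h2, h3, h4⟩ := h
  have hz : 0 < 1 + Z ^ 2 := by positivity
  have hs := sq_sqrt hz.le
  have key : 1 - ((X ^ 2 + Y ^ 2 - Z ^ 2) / (2 * X * Y * √(1 + Z ^ 2))) ^ 2 =
      (4 * Y ^ 2 * Z ^ 2 - (Y ^ 2 + Z ^ 2 - X ^ 2) ^ 2 + 4 * X ^ 2 * Y ^ 2 * Z ^ 2) /
        (2 * X * Y * √(1 + Z ^ 2)) ^ 2 := by
    have : 0 < √(1 + Z ^ 2) := sqrt_pos.2 hz
    rw [div_pow, eq_div_iff (by positivity), sub_mul, div_mul_cancel₀ _ (by positivity)]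
    rw [mul_pow _ (√(1 + Z ^ 2)), hs]
    ring
  have hsq : ((X ^ 2 + Y ^ 2 - Z ^ 2) / (2 * X * Y * √(1 + Z ^ 2))) ^ 2 ≤ 1 := by
    have : 0 ≤ (4 * Y ^ 2 * Z ^ 2 - (Y ^ 2 + Z ^ 2 - X ^ 2) ^ 2 + 4 * X ^ 2 * Y ^ 2 * Z ^ 2) /
        (2 * X * Y * √(1 + Z ^ 2)) ^ 2 := by positivity
    linarith
  rw [sq_le_one_iff_abs_le_one, abs_le] at hsq
  constructor
  · rw [sin_pi_div_two_sub, circumAngle, cos_arccos hsq.1 hsq.2]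
  · rw [cos_pi_div_two_sub, circumAngle, sin_arccos, key, sqrt_div h4.le, sqrt_sq (by positivity)]

theorem cos_pos (h : IsSideTriple X Y Z) : 0 < cos (π / 2 - circumAngle X Y Z) := by
  rw [h.sin_cos_circumAngle.2]
  obtain ⟨h1, h2, h3, h4⟩ := h
  have := sqrt_pos.2 h4
  positivity

theorem mem_Ioo (h : IsSideTriple X Y Z) :
    π / 2 - circumAngle X Y Z ∈ Set.Ioo (-(π / 2)) (π / 2) := by
  have h0 : 0 ≤ circumAngle X Y Z := arccos_nonneg _
  have h1 : circumAngle X Y Z ≤ π := arccos_le_pi _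
  have hc := h.cos_pos
  rw [cos_pi_div_two_sub] at hc
  constructor
  · rcases h1.eq_or_lt with h1 | h1
    · rw [h1, sin_pi] at hc; exact absurd hc (lt_irrefl _)
    · linarith
  · rcases h0.eq_or_lt with h0 | h0
    · rw [← h0, sin_zero] at hc; exact absurd hc (lt_irrefl _)
    · linarith

/-- The sum is the inner angle between the sides `X` and `Z`, and the cosine formula is the law of
cosines in terms of half lengths. -/
theorem sin_cos_add (h : IsSideTriple X Y Z) :
    sin (π / 2 - circumAngle X Y Z + (π / 2 - circumAngle Y Z X)) =
      √(4 * Y ^ 2 * Z ^ 2 - (Y ^ 2 + Z ^ 2 - X ^ 2) ^ 2 + 4 * X ^ 2 * Y ^ 2 * Z ^ 2)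
        / (2 * X * Z * √(1 + X ^ 2) * √(1 + Z ^ 2)) ∧
    cos (π / 2 - circumAngle X Y Z + (π / 2 - circumAngle Y Z X)) =
      (X ^ 2 + Z ^ 2 - Y ^ 2 + 2 * X ^ 2 * Z ^ 2)
        / (2 * X * Z * √(1 + X ^ 2) * √(1 + Z ^ 2)) := by
  have e1 := h.sin_cos_circumAngle
  have e2 := h.rotate.sin_cos_circumAngle
  rw [show 4 * Z ^ 2 * X ^ 2 - (Z ^ 2 + X ^ 2 - Y ^ 2) ^ 2 + 4 * Y ^ 2 * Z ^ 2 * X ^ 2 =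
    4 * Y ^ 2 * Z ^ 2 - (Y ^ 2 + Z ^ 2 - X ^ 2) ^ 2 + 4 * X ^ 2 * Y ^ 2 * Z ^ 2 by ring] at e2
  obtain ⟨h1, h2, h3, h4⟩ := h
  rw [sin_add, cos_add, e1.1, e1.2, e2.1, e2.2]
  have hD := sq_sqrt h4.le
  have hx : 0 < √(1 + X ^ 2) := sqrt_pos.2 (by positivity)
  have hz : 0 < √(1 + Z ^ 2) := sqrt_pos.2 (by positivity)
  set R := √(4 * Y ^ 2 * Z ^ 2 - (Y ^ 2 + Z ^ 2 - X ^ 2) ^ 2 + 4 * X ^ 2 * Y ^ 2 * Z ^ 2)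
  set x := √(1 + X ^ 2)
  set z := √(1 + Z ^ 2)
  constructor
  · field_simp
    ring
  · field_simp
    rw [hD]
    ring

theorem cos_sum (h : IsSideTriple X Y Z) :
    cos (π / 2 - circumAngle X Y Z + (π / 2 - circumAngle Y Z X)
        + (π / 2 - circumAngle Z X Y)) =
      √(4 * Y ^ 2 * Z ^ 2 - (Y ^ 2 + Z ^ 2 - X ^ 2) ^ 2 + 4 * X ^ 2 * Y ^ 2 * Z ^ 2)
        / (2 * √(1 + X ^ 2) * √(1 + Y ^ 2) * √(1 + Z ^ 2)) := by
  have e1 := h.sin_cos_add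
  have e2 := h.rotate.rotate.sin_cos_circumAngle
  rw [show 4 * X ^ 2 * Y ^ 2 - (X ^ 2 + Y ^ 2 - Z ^ 2) ^ 2 + 4 * Z ^ 2 * X ^ 2 * Y ^ 2 =
    4 * Y ^ 2 * Z ^ 2 - (Y ^ 2 + Z ^ 2 - X ^ 2) ^ 2 + 4 * X ^ 2 * Y ^ 2 * Z ^ 2 by ring] at e2
  obtain ⟨h1, h2, h3, h4⟩ := h
  rw [cos_add, e1.1, e1.2, e2.1, e2.2]
  have hx : 0 < √(1 + X ^ 2) := sqrt_pos.2 (by positivity)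
  have hy : 0 < √(1 + Y ^ 2) := sqrt_pos.2 (by positivity)
  have hz : 0 < √(1 + Z ^ 2) := sqrt_pos.2 (by positivity)
  set R := √(4 * Y ^ 2 * Z ^ 2 - (Y ^ 2 + Z ^ 2 - X ^ 2) ^ 2 + 4 * X ^ 2 * Y ^ 2 * Z ^ 2)
  field_simp
  ring

/-- The sum exceeds `-π`, so its positive sine excludes nonpositive values. -/
theorem add_pos (h : IsSideTriple X Y Z) :
    0 < π / 2 - circumAngle X Y Z + (π / 2 - circumAngle Y Z X) := by
  have hs : 0 < sin (π / 2 - circumAngle X Y Z + (π / 2 - circumAngle Y Z X)) := by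
    rw [h.sin_cos_add.1]
    obtain ⟨h1, h2, h3, h4⟩ := h
    have := sqrt_pos.2 h4
    positivity
  have h1 := h.mem_Ioo
  have h2 := h.rotate.mem_Ioo
  by_contra! hle
  have := sin_nonpos_of_nonpos_of_neg_pi_le hle (by linarith [h1.1, h2.1])
  linarith

theorem isAngleTriple (h : IsSideTriple X Y Z) :
    IsAngleTriple (π / 2 - circumAngle X Y Z) (π / 2 - circumAngle Y Z X)
      (π / 2 - circumAngle Z X Y) := by
  have a1 := h.add_pos
  have a2 := h.rotate.add_pos
  have a3 := h.rotate.rotate.add_pos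
  refine ⟨?_, a1, a2, by linarith⟩
  have hc := h.cos_sum
  have h1 := h.mem_Ioo
  have h2 := h.rotate.mem_Ioo
  have h3 := h.rotate.rotate.mem_Ioo
  -- The total is less than `3 * π / 2`, so its positive cosine forces it below `π / 2`.
  by_contra! hle
  have := cos_nonpos_of_pi_div_two_le_of_le hle (by linarith [h1.2, h2.2, h3.2])
  have hpos : 0 < √(4 * Y ^ 2 * Z ^ 2 - (Y ^ 2 + Z ^ 2 - X ^ 2) ^ 2 + 4 * X ^ 2 * Y ^ 2 * Z ^ 2)
        / (2 * √(1 + X ^ 2) * √(1 + Y ^ 2) * √(1 + Z ^ 2)) := by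
    have := sqrt_pos.2 h.disc_pos
    positivity
  linarith

/-- The dual law of cosines in half-angle form. It identifies `angleForm` with the pairing of an
angle variation with twice the logarithms of the sides. -/
theorem two_mul_log (h : IsSideTriple X Y Z) :
    2 * log Z = log (cos (π / 2 - circumAngle X Y Z + (π / 2 - circumAngle Y Z X)
        + (π / 2 - circumAngle Z X Y))) + log (cos (π / 2 - circumAngle X Y Z))
      - log (sin (π / 2 - circumAngle X Y Z + (π / 2 - circumAngle Y Z X)))
      - log (sin (π / 2 - circumAngle X Y Z + (π / 2 - circumAngle Z X Y))) := by
  obtain ⟨c1, c2, c3, c4⟩ := h.isAngleTriple.cos_pos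
  obtain ⟨s1, s2, s3⟩ := h.isAngleTriple.sin_pos
  have e : 2 * log Z = log (Z ^ 2) := by rw [log_pow]; norm_num
  rw [← log_mul c4.ne' c1.ne', ← log_div (by positivity) s1.ne', ← log_div (by positivity) s3.ne',
    e]
  congr 1
  rw [add_comm (π / 2 - circumAngle X Y Z) (π / 2 - circumAngle Z X Y), h.cos_sum,
    h.rotate.rotate.sin_cos_add.1, h.sin_cos_add.1, h.sin_cos_circumAngle.2]
  rw [show 4 * X ^ 2 * Y ^ 2 - (X ^ 2 + Y ^ 2 - Z ^ 2) ^ 2 + 4 * Z ^ 2 * X ^ 2 * Y ^ 2 =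
    4 * Y ^ 2 * Z ^ 2 - (Y ^ 2 + Z ^ 2 - X ^ 2) ^ 2 + 4 * X ^ 2 * Y ^ 2 * Z ^ 2 by ring]
  obtain ⟨h1, h2, h3, h4⟩ := h
  have hx : 0 < √(1 + X ^ 2) := sqrt_pos.2 (by positivity)
  have hy : 0 < √(1 + Y ^ 2) := sqrt_pos.2 (by positivity)
  have hz : 0 < √(1 + Z ^ 2) := sqrt_pos.2 (by positivity)
  have hD := sqrt_pos.2 h4
  set R := √(4 * Y ^ 2 * Z ^ 2 - (Y ^ 2 + Z ^ 2 - X ^ 2) ^ 2 + 4 * X ^ 2 * Y ^ 2 * Z ^ 2)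
  field_simp

/-- The pairing of the variations of the circumscribing angles with the variations of the
logarithmic edge lengths of two nondegenerate triangles is definite. -/
theorem pairing_pos (h : IsSideTriple X Y Z) {X' Y' Z' : ℝ} (h' : IsSideTriple X' Y' Z')
    (hne : ¬ (X = X' ∧ Y = Y' ∧ Z = Z')) :
    0 < (log X - log X') * (circumAngle Y Z X - circumAngle Y' Z' X')
      + (log Y - log Y') * (circumAngle Z X Y - circumAngle Z' X' Y')
      + (log Z - log Z') * (circumAngle X Y Z - circumAngle X' Y' Z') := by
  have l1 := h.two_mul_log
  have l2 := h.rotate.two_mul_log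
  have l3 := h.rotate.rotate.two_mul_log
  have l1' := h'.two_mul_log
  have l2' := h'.rotate.two_mul_log
  have l3' := h'.rotate.rotate.two_mul_log
  have hA := h.isAngleTriple
  have hA' := h'.isAngleTriple
  set p := π / 2 - circumAngle X Y Z with hp
  set q := π / 2 - circumAngle Y Z X with hq
  set r := π / 2 - circumAngle Z X Y with hr
  set p' := π / 2 - circumAngle X' Y' Z' with hp'
  set q' := π / 2 - circumAngle Y' Z' X' with hq'
  set r' := π / 2 - circumAngle Z' X' Y' with hr'
  rw [show q + r + p = p + q + r by ring, show q + p = p + q by ring] at l2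
  rw [show r + p + q = p + q + r by ring, show r + q = q + r by ring,
    show r + p = p + r by ring] at l3
  rw [show q' + r' + p' = p' + q' + r' by ring, show q' + p' = p' + q' by ring] at l2'
  rw [show r' + p' + q' = p' + q' + r' by ring, show r' + q' = q' + r' by ring,
    show r' + p' = p' + r' by ring] at l3'
  -- A hyperbolic triangle is determined by its angles: equal triples give equal logarithmic lengths
  -- by the formulas above.
  have key : ¬ (p = p' ∧ q = q' ∧ r = r') := by
    rintro ⟨h1, h2, h3⟩
    rw [← h1, ← h2, ← h3] at l1' l2' l3'
    exact hne ⟨log_injOn_pos h.pos_left h'.pos_left (by linarith),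
      log_injOn_pos h.pos_mid h'.pos_mid (by linarith),
      log_injOn_pos h.pos_right h'.pos_right (by linarith)⟩
  have hlt := hA'.angleForm_lt hA key
  -- Passing from the circumscribing angles to their complements changes the sign, which turns the
  -- strict decrease of `angleForm` into positivity.
  have E : (log X - log X') * (circumAngle Y Z X - circumAngle Y' Z' X')
      + (log Y - log Y') * (circumAngle Z X Y - circumAngle Z' X' Y')
      + (log Z - log Z') * (circumAngle X Y Z - circumAngle X' Y' Z')
      = -((2 * log X - 2 * log X') * (q - q') + (2 * log Y - 2 * log Y') * (r - r')
        + (2 * log Z - 2 * log Z') * (p - p')) / 2 := by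
    rw [hp, hq, hr, hp', hq', hr']; ring
  rw [E, l1, l2, l3, l1', l2', l3']
  unfold angleForm at hlt
  linarith

end IsSideTriple

/-! ### The Poincaré disk and congruence of triangles. -/

section DiskModel

open Complex

theorem inner_eq_re_mul_add_im_mul (u w : ℂ) : inner ℝ u w = u.re * w.re + u.im * w.im := by
  rw [Complex.inner]; simp; ring

theorem lineSide_eq (u w : ℂ) : lineSide u w = u.re * w.im - u.im * w.re := by
  simp [lineSide]; ring

theorem sq_norm_eq (w : ℂ) : ‖w‖ ^ 2 = w.re ^ 2 + w.im ^ 2 := by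
  rw [Complex.sq_norm, Complex.normSq_apply]; ring

theorem inner_sq_add_lineSide_sq (u w : ℂ) :
    (inner ℝ u w : ℝ) ^ 2 + lineSide u w ^ 2 = ‖u‖ ^ 2 * ‖w‖ ^ 2 := by
  rw [inner_eq_re_mul_add_im_mul, lineSide_eq, sq_norm_eq, sq_norm_eq]; ring

/-- A product of two determinants is a Gram determinant, so lying on the same side of a line is
expressible by inner products alone. -/
theorem lineSide_mul_lineSide (u w v : ℂ) :
    lineSide u w * lineSide u v =
      ‖u‖ ^ 2 * inner ℝ w v - inner ℝ u w * inner ℝ u v := by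
  simp only [inner_eq_re_mul_add_im_mul, lineSide_eq, sq_norm_eq]; ring

theorem eq_of_inner_eq_of_inner_eq {u v w w' : ℂ} (h : lineSide u v ≠ 0)
    (h1 : (inner ℝ u w : ℝ) = inner ℝ u w') (h2 : (inner ℝ v w : ℝ) = inner ℝ v w') : w = w' := by
  rw [lineSide_eq] at h
  simp only [inner_eq_re_mul_add_im_mul] at h1 h2
  apply Complex.ext <;> apply mul_left_cancel₀ h
  · linear_combination v.im * h1 - u.im * h2
  · linear_combination u.re * h2 - v.re * h1

theorem eq_of_inner_eq_of_lineSide_eq {u w w' : ℂ} (hu : u ≠ 0)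
    (h1 : (inner ℝ u w : ℝ) = inner ℝ u w') (h2 : lineSide u w = lineSide u w') : w = w' := by
  have h : u.re ^ 2 + u.im ^ 2 ≠ 0 := by
    rw [← sq_norm_eq]; positivity
  rw [lineSide_eq, lineSide_eq] at h2
  simp only [inner_eq_re_mul_add_im_mul] at h1
  apply Complex.ext <;> apply mul_left_cancel₀ h
  · linear_combination u.re * h1 - u.im * h2
  · linear_combination u.im * h1 + u.re * h2

/-- Points on the same side of a line are determined by two distances. -/
theorem eq_of_inner_eq_of_norm_eq {u w w' : ℂ} (hu : u ≠ 0)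
    (h1 : (inner ℝ u w : ℝ) = inner ℝ u w') (h2 : ‖w‖ = ‖w'‖)
    (h3 : 0 < lineSide u w * lineSide u w') : w = w' := by
  refine eq_of_inner_eq_of_lineSide_eq hu h1 ?_
  have e1 := inner_sq_add_lineSide_sq u w
  have e2 := inner_sq_add_lineSide_sq u w'
  rw [h1, h2] at e1
  have e3 : lineSide u w ^ 2 = lineSide u w' ^ 2 := by linarith
  rcases sq_eq_sq_iff_eq_or_eq_neg.1 e3 with h | h
  · exact h
  · rw [h] at h3
    nlinarith [sq_nonneg (lineSide u w')]

/-- `sinh` of half of the hyperbolic distance. -/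
noncomputable def halfSinh (y z : UpperHalfPlane) : ℝ := Real.sinh (dist y z / 2)

theorem halfSinh_comm (y z : UpperHalfPlane) : halfSinh y z = halfSinh z y := by
  rw [halfSinh, dist_comm, halfSinh]

theorem halfSinh_nonneg (y z : UpperHalfPlane) : 0 ≤ halfSinh y z :=
  Real.sinh_nonneg_iff.2 (by positivity)

theorem halfSinh_pos {y z : UpperHalfPlane} (h : y ≠ z) : 0 < halfSinh y z :=
  Real.sinh_pos_iff.2 (half_pos (dist_pos.2 h))

theorem dist_eq_of_halfSinh_eq {y z y' z' : UpperHalfPlane} (h : halfSinh y z = halfSinh y' z') :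
    dist y z = dist y' z' := by
  have := Real.sinh_injective h
  linarith

theorem halfSinh_sq (y z : UpperHalfPlane) :
    halfSinh y z ^ 2 = normSq ((y : ℂ) - z) / (4 * (y.im * z.im)) := by
  have := y.im_pos
  have := z.im_pos
  rw [halfSinh, UpperHalfPlane.sinh_half_dist, div_pow, mul_pow, Real.sq_sqrt (by positivity),
    Complex.dist_eq, Complex.sq_norm]
  norm_num

theorem sub_conj_ne_zero (a z : UpperHalfPlane) : (z : ℂ) - (starRingEnd ℂ) (a : ℂ) ≠ 0 := by
  intro h
  have := congrArg Complex.im h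
  simp at this
  linarith [a.im_pos, z.im_pos]

theorem poincareDisk_self (a : UpperHalfPlane) : poincareDisk a a = 0 := by
  simp [poincareDisk]

theorem one_sub_norm_poincareDisk_sq (a z : UpperHalfPlane) :
    1 - ‖poincareDisk a z‖ ^ 2 =
      4 * (a.im * z.im) / normSq ((z : ℂ) - (starRingEnd ℂ) (a : ℂ)) := by
  have h := normSq_pos.2 (sub_conj_ne_zero a z)
  rw [Complex.sq_norm, poincareDisk, normSq_div, eq_div_iff h.ne', sub_mul,
    div_mul_cancel₀ _ h.ne']
  simp [normSq_apply]
  ring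

theorem norm_poincareDisk_lt_one (a z : UpperHalfPlane) : ‖poincareDisk a z‖ < 1 := by
  have h := normSq_pos.2 (sub_conj_ne_zero a z)
  have h1 : 0 < 4 * (a.im * z.im) / normSq ((z : ℂ) - (starRingEnd ℂ) (a : ℂ)) := by
    have := a.im_pos
    have := z.im_pos
    positivity
  rw [← one_sub_norm_poincareDisk_sq] at h1
  nlinarith [norm_nonneg (poincareDisk a z)]

/-- The distance formula of the disk model. Through it the norms and inner products of disk
coordinates become functions of hyperbolic distances. -/
theorem norm_poincareDisk_sub_sq (a y z : UpperHalfPlane) :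
    ‖poincareDisk a y - poincareDisk a z‖ ^ 2 =
      halfSinh y z ^ 2 * ((1 - ‖poincareDisk a y‖ ^ 2) * (1 - ‖poincareDisk a z‖ ^ 2)) := by
  have h1 := sub_conj_ne_zero a y
  have h2 := sub_conj_ne_zero a z
  have h1' := (normSq_pos.2 h1).ne'
  have h2' := (normSq_pos.2 h2).ne'
  have ha := a.im_pos.ne'
  have hy := y.im_pos.ne'
  have hz := z.im_pos.ne'
  have e : poincareDisk a y - poincareDisk a z = ((y : ℂ) - z) * ((a : ℂ) - (starRingEnd ℂ) (a : ℂ))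
      / (((y : ℂ) - (starRingEnd ℂ) (a : ℂ)) * ((z : ℂ) - (starRingEnd ℂ) (a : ℂ))) := by
    rw [poincareDisk, poincareDisk]
    field_simp
    ring
  have e2 : normSq ((a : ℂ) - (starRingEnd ℂ) (a : ℂ)) = 4 * a.im ^ 2 := by
    simp [normSq_apply]; ring
  rw [one_sub_norm_poincareDisk_sq, one_sub_norm_poincareDisk_sq, halfSinh_sq, e, Complex.sq_norm,
    normSq_div, normSq_mul, normSq_mul, e2]
  field_simp

theorem norm_poincareDisk_sq (a z : UpperHalfPlane) :
    ‖poincareDisk a z‖ ^ 2 = halfSinh a z ^ 2 / (1 + halfSinh a z ^ 2) := by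
  have h := norm_poincareDisk_sub_sq a a z
  rw [poincareDisk_self, zero_sub, norm_neg, norm_zero] at h
  rw [eq_div_iff (by positivity)]
  linarith

theorem one_sub_norm_poincareDisk_sq' (a z : UpperHalfPlane) :
    1 - ‖poincareDisk a z‖ ^ 2 = 1 / (1 + halfSinh a z ^ 2) := by
  rw [norm_poincareDisk_sq, eq_div_iff (by positivity), sub_mul, div_mul_cancel₀ _ (by positivity)]
  ring

theorem inner_poincareDisk (a y z : UpperHalfPlane) :
    inner ℝ (poincareDisk a y) (poincareDisk a z) =
      (halfSinh a y ^ 2 + halfSinh a z ^ 2 + 2 * halfSinh a y ^ 2 * halfSinh a z ^ 2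
        - halfSinh y z ^ 2) / (2 * (1 + halfSinh a y ^ 2) * (1 + halfSinh a z ^ 2)) := by
  have h := norm_sub_sq_real (poincareDisk a y) (poincareDisk a z)
  rw [norm_poincareDisk_sub_sq, one_sub_norm_poincareDisk_sq', one_sub_norm_poincareDisk_sq',
    norm_poincareDisk_sq, norm_poincareDisk_sq] at h
  have h1 : 0 < 1 + halfSinh a y ^ 2 := by positivity
  have h2 : 0 < 1 + halfSinh a z ^ 2 := by positivity
  have e : (inner ℝ (poincareDisk a y) (poincareDisk a z) : ℝ) =
      (halfSinh a y ^ 2 / (1 + halfSinh a y ^ 2) + halfSinh a z ^ 2 / (1 + halfSinh a z ^ 2)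
        - halfSinh y z ^ 2 * (1 / (1 + halfSinh a y ^ 2) * (1 / (1 + halfSinh a z ^ 2)))) / 2 := by
    linarith
  rw [e]
  field_simp
  ring

theorem inner_poincareDisk_congr {a y z a' y' z' : UpperHalfPlane} (h1 : dist a y = dist a' y')
    (h2 : dist a z = dist a' z') (h3 : dist y z = dist y' z') :
    (inner ℝ (poincareDisk a y) (poincareDisk a z) : ℝ) =
      inner ℝ (poincareDisk a' y') (poincareDisk a' z') := by
  simp only [inner_poincareDisk, halfSinh, h1, h2, h3]

theorem norm_poincareDisk_congr {a z a' z' : UpperHalfPlane} (h : dist a z = dist a' z') :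
    ‖poincareDisk a z‖ = ‖poincareDisk a' z'‖ := by
  rw [← sq_eq_sq₀ (norm_nonneg _) (norm_nonneg _), norm_poincareDisk_sq, norm_poincareDisk_sq,
    halfSinh, h, halfSinh]

theorem poincareDisk_injective (a : UpperHalfPlane) : Function.Injective (poincareDisk a) := by
  intro y z h
  have h1 := norm_poincareDisk_sub_sq a y z
  rw [h, sub_self, norm_zero, one_sub_norm_poincareDisk_sq'] at h1
  have h2 : halfSinh y z ^ 2 = 0 := by
    have : 0 < 1 / (1 + halfSinh a z ^ 2) * (1 / (1 + halfSinh a z ^ 2)) := by positivity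
    rcases mul_eq_zero.1 (h1.symm.trans (by norm_num)) with h | h
    · exact h
    · exact absurd h this.ne'
  by_contra hne
  exact (halfSinh_pos hne).ne' (pow_eq_zero_iff two_ne_zero |>.1 h2)

theorem poincareDisk_ne_zero {a z : UpperHalfPlane} (h : a ≠ z) : poincareDisk a z ≠ 0 := by
  rw [← poincareDisk_self a]
  exact fun h' => h (poincareDisk_injective a h').symm

theorem exists_poincareDisk_eq (a : UpperHalfPlane) {w : ℂ} (hw : ‖w‖ < 1) :
    ∃ z, poincareDisk a z = w := by
  have hw1 : 1 - w ≠ 0 := by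
    intro h
    rw [← sub_eq_zero.1 h] at hw
    simp at hw
  have hn := normSq_pos.2 hw1
  have hw2 : normSq w < 1 := by
    rw [← Complex.sq_norm]; nlinarith [norm_nonneg w]
  have him : (((a : ℂ) - (starRingEnd ℂ) (a : ℂ) * w) / (1 - w)).im
      = a.im * (1 - normSq w) / normSq (1 - w) := by
    rw [div_eq_mul_inv, Complex.inv_def, ← mul_assoc, Complex.im_mul_ofReal, div_eq_mul_inv]
    congr 1
    simp [normSq_apply]
    ring
  -- The solution `z` of `(z - a) / (z - conj a) = w`.
  refine ⟨⟨((a : ℂ) - (starRingEnd ℂ) (a : ℂ) * w) / (1 - w), ?_⟩, ?_⟩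
  · rw [him]
    have := a.im_pos
    have := sub_pos.2 hw2
    positivity
  · have ha : (a : ℂ) - (starRingEnd ℂ) (a : ℂ) ≠ 0 := sub_conj_ne_zero a a
    rw [poincareDisk, UpperHalfPlane.coe_mk]
    have e1 : ((a : ℂ) - (starRingEnd ℂ) (a : ℂ) * w) / (1 - w) - a =
        w * ((a : ℂ) - (starRingEnd ℂ) (a : ℂ)) / (1 - w) := by
      field_simp; ring
    have e2 : ((a : ℂ) - (starRingEnd ℂ) (a : ℂ) * w) / (1 - w) - (starRingEnd ℂ) (a : ℂ) =
        ((a : ℂ) - (starRingEnd ℂ) (a : ℂ)) / (1 - w) := by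
      field_simp; ring
    rw [e1, e2]
    field_simp

theorem dist_eq_of_norm_poincareDisk_sub_eq {a y z a' y' z' : UpperHalfPlane}
    (h1 : ‖poincareDisk a y‖ = ‖poincareDisk a' y'‖) (h2 : ‖poincareDisk a z‖ = ‖poincareDisk a' z'‖)
    (h3 : ‖poincareDisk a y - poincareDisk a z‖ = ‖poincareDisk a' y' - poincareDisk a' z'‖) :
    dist y z = dist y' z' := by
  apply dist_eq_of_halfSinh_eq
  rw [← sq_eq_sq₀ (halfSinh_nonneg _ _) (halfSinh_nonneg _ _)]
  have e := norm_poincareDisk_sub_sq a y z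
  rw [h3, norm_poincareDisk_sub_sq a' y' z', h1, h2] at e
  have : 0 < (1 - ‖poincareDisk a' y'‖ ^ 2) * (1 - ‖poincareDisk a' z'‖ ^ 2) := by
    rw [one_sub_norm_poincareDisk_sq', one_sub_norm_poincareDisk_sq']
    positivity
  exact (mul_right_cancel₀ this.ne' e).symm

/-- A linear isometry of the Poincaré disk is an isometry of the hyperbolic plane. -/
theorem exists_isometryEquiv_poincareDisk (a a' : UpperHalfPlane) (L : ℂ ≃ₗᵢ[ℝ] ℂ) :
    ∃ g : UpperHalfPlane ≃ᵢ UpperHalfPlane, ∀ z, poincareDisk a' (g z) = L (poincareDisk a z) := by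
  have h1 : ∀ z, ∃ z', poincareDisk a' z' = L (poincareDisk a z) := fun z =>
    exists_poincareDisk_eq a' (by rw [L.norm_map]; exact norm_poincareDisk_lt_one a z)
  have h2 : ∀ z, ∃ z', poincareDisk a z' = L.symm (poincareDisk a' z) := fun z =>
    exists_poincareDisk_eq a (by rw [L.symm.norm_map]; exact norm_poincareDisk_lt_one a' z)
  choose g hg using h1
  choose k hk using h2
  refine ⟨IsometryEquiv.mk' g k (fun z => poincareDisk_injective a' ?_) ?_, hg⟩
  · rw [hg, hk, L.apply_symm_apply]
  · refine Isometry.of_dist_eq fun y z =>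
      dist_eq_of_norm_poincareDisk_sub_eq (a := a') (a' := a) ?_ ?_ ?_
    · rw [hg, L.norm_map]
    · rw [hg, L.norm_map]
    · rw [hg, hg, ← map_sub, L.norm_map]

theorem exists_circle_coe_eq {w : ℂ} (h : ‖w‖ = 1) : ∃ k : Circle, (k : ℂ) = w :=
  ⟨⟨w, mem_sphere_zero_iff_norm.2 h⟩, rfl⟩

/-- Equal norms and inner products leave only the sign of `lineSide` undecided. A rotation works if
the signs agree, and conjugation followed by a rotation if they differ. -/
theorem exists_linearIsometryEquiv_apply_eq {u v u' v' : ℂ} (hu : u ≠ 0) (h1 : ‖u‖ = ‖u'‖)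
    (h2 : ‖v‖ = ‖v'‖) (h3 : (inner ℝ u v : ℝ) = inner ℝ u' v') :
    ∃ L : ℂ ≃ₗᵢ[ℝ] ℂ, L u = u' ∧ L v = v' := by
  have hu' : u' ≠ 0 := by rw [← norm_ne_zero_iff, ← h1]; exact norm_ne_zero_iff.2 hu
  have hc : (starRingEnd ℂ) u ≠ 0 := (map_ne_zero _).2 hu
  have hc' : (starRingEnd ℂ) u' ≠ 0 := (map_ne_zero _).2 hu'
  have hn : u * (starRingEnd ℂ) u = u' * (starRingEnd ℂ) u' := by
    rw [Complex.mul_conj', Complex.mul_conj', h1]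
  have hre : ((starRingEnd ℂ) u * v).re = ((starRingEnd ℂ) u' * v').re := by
    have h4 := h3
    rw [Complex.inner, Complex.inner] at h4
    rwa [mul_comm, mul_comm _ v']
  have e1 := inner_sq_add_lineSide_sq u v
  have e2 := inner_sq_add_lineSide_sq u' v'
  rw [h1, h2, h3] at e1
  have e3 : lineSide u v ^ 2 = lineSide u' v' ^ 2 := by linarith
  rcases sq_eq_sq_iff_eq_or_eq_neg.1 e3 with h | h
  · have hP : (starRingEnd ℂ) u * v = (starRingEnd ℂ) u' * v' := Complex.ext hre h
    obtain ⟨k, hk⟩ := exists_circle_coe_eq (w := u' / u) (by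
      rw [norm_div, h1, div_self (norm_ne_zero_iff.2 hu')])
    refine ⟨rotation k, ?_, ?_⟩
    · rw [rotation_apply, hk]
      simp [hu]
    · rw [rotation_apply, hk]
      apply mul_left_cancel₀ hc'
      rw [← hP]
      field_simp
      linear_combination -v * hn
  · have hP : u * (starRingEnd ℂ) v = (starRingEnd ℂ) u' * v' := by
      have hP : (starRingEnd ℂ) ((starRingEnd ℂ) u * v) = (starRingEnd ℂ) u' * v' :=
        Complex.ext (by rw [conj_re, hre]) (by rw [conj_im]; unfold lineSide at h; linarith)
      rwa [map_mul, conj_conj] at hP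
    obtain ⟨k, hk⟩ := exists_circle_coe_eq (w := u' / (starRingEnd ℂ) u) (by
      rw [norm_div, RCLike.norm_conj, h1, div_self (norm_ne_zero_iff.2 hu')])
    refine ⟨conjLIE.trans (rotation k), ?_, ?_⟩
    · rw [LinearIsometryEquiv.trans_apply, rotation_apply, hk, conjLIE_apply]
      simp [hu]
    · rw [LinearIsometryEquiv.trans_apply, rotation_apply, hk, conjLIE_apply]
      apply mul_left_cancel₀ hc'
      rw [← hP]
      field_simp
      linear_combination -(starRingEnd ℂ) v * hn

/-- Triangles with equal side lengths are congruent. -/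
theorem exists_isometryEquiv_of_dist_eq {a b c a' b' c' : UpperHalfPlane} (hab : a ≠ b)
    (h1 : dist a b = dist a' b') (h2 : dist a c = dist a' c') (h3 : dist b c = dist b' c') :
    ∃ g : UpperHalfPlane ≃ᵢ UpperHalfPlane, g a = a' ∧ g b = b' ∧ g c = c' := by
  obtain ⟨L, hL1, hL2⟩ := exists_linearIsometryEquiv_apply_eq (poincareDisk_ne_zero hab)
    (norm_poincareDisk_congr h1) (norm_poincareDisk_congr h2) (inner_poincareDisk_congr h1 h2 h3)
  obtain ⟨g, hg⟩ := exists_isometryEquiv_poincareDisk a a' L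
  refine ⟨g, ?_, ?_, ?_⟩ <;> apply poincareDisk_injective a' <;> rw [hg]
  · rw [poincareDisk_self, poincareDisk_self, map_zero]
  · exact hL1
  · exact hL2

/-- The side of the geodesic through `a` and `b` on which `c` lies, as the sign of a determinant. -/
noncomputable def hypSide (a b c : UpperHalfPlane) : ℝ :=
  lineSide (poincareDisk a b) (poincareDisk a c)

/-- A single `hypSide` may change sign under an orientation-reversing isometry; a product of two
depends on distances only. -/
theorem hypSide_mul_congr {a b c d a' b' c' d' : UpperHalfPlane} (hab : dist a b = dist a' b')
    (hac : dist a c = dist a' c') (had : dist a d = dist a' d') (hbc : dist b c = dist b' c')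
    (hbd : dist b d = dist b' d') (hcd : dist c d = dist c' d') :
    hypSide a b c * hypSide a b d = hypSide a' b' c' * hypSide a' b' d' := by
  unfold hypSide
  rw [lineSide_mul_lineSide, lineSide_mul_lineSide, norm_poincareDisk_congr hab,
    inner_poincareDisk_congr hac had hcd, inner_poincareDisk_congr hab hac hbc,
    inner_poincareDisk_congr hab had hbd]

theorem IsometryEquiv.hypSide_mul (g : UpperHalfPlane ≃ᵢ UpperHalfPlane)
    (a b c d : UpperHalfPlane) :
    hypSide (g a) (g b) (g c) * hypSide (g a) (g b) (g d) = hypSide a b c * hypSide a b d := by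
  apply hypSide_mul_congr <;> exact g.dist_eq _ _

theorem hypSide_ne_zero_congr {a b c a' b' c' : UpperHalfPlane} (h : hypSide a b c ≠ 0)
    (hab : dist a b = dist a' b') (hac : dist a c = dist a' c') (hbc : dist b c = dist b' c') :
    hypSide a' b' c' ≠ 0 := by
  have h1 := hypSide_mul_congr hab hac hac hbc hbc (by simp : dist c c = dist c' c')
  intro h0
  rw [h0, mul_zero, mul_self_eq_zero] at h1
  exact h h1

/-- Isometries of the hyperbolic plane agree if they agree at three points in general position. -/
theorem IsometryEquiv.ext_of_hypSide_ne_zero {g k : UpperHalfPlane ≃ᵢ UpperHalfPlane}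
    {a b c : UpperHalfPlane} (h : hypSide a b c ≠ 0) (ha : g a = k a) (hb : g b = k b)
    (hc : g c = k c) : g = k := by
  ext1 z
  apply poincareDisk_injective (g a)
  have h' : hypSide (g a) (g b) (g c) ≠ 0 :=
    hypSide_ne_zero_congr h (g.dist_eq _ _).symm (g.dist_eq _ _).symm (g.dist_eq _ _).symm
  refine eq_of_inner_eq_of_inner_eq h' ?_ ?_
  · refine inner_poincareDisk_congr rfl ?_ ?_
    · rw [g.dist_eq, ha, k.dist_eq]
    · rw [g.dist_eq, hb, k.dist_eq]
  · refine inner_poincareDisk_congr rfl ?_ ?_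
    · rw [g.dist_eq, ha, k.dist_eq]
    · rw [g.dist_eq, hc, k.dist_eq]

/-- Points on the same side of a geodesic are determined by their distances from two points. -/
theorem eq_of_dist_eq_of_hypSide_mul_pos {a b y z : UpperHalfPlane} (h1 : dist a y = dist a z)
    (h2 : dist b y = dist b z) (h : 0 < hypSide a b y * hypSide a b z) : y = z := by
  apply poincareDisk_injective a
  refine eq_of_inner_eq_of_norm_eq ?_ (inner_poincareDisk_congr rfl h1 h2)
    (norm_poincareDisk_congr h1) h
  intro h0
  simp [hypSide, h0, lineSide] at h

/-- Isometries which agree on a nonempty open set are equal. -/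
theorem IsometryEquiv.eq_of_eqOn_nhds {g k : UpperHalfPlane ≃ᵢ UpperHalfPlane}
    {a : UpperHalfPlane} {U : Set UpperHalfPlane} (hU : U ∈ nhds a) (h : Set.EqOn g k U) :
    g = k := by
  obtain ⟨r, hr, hrU⟩ := Metric.mem_nhds_iff.1 hU
  -- Points at hyperbolic distance `r / 2` from `a` form the circle of radius `tanh (r / 4)` in the
  -- disk. Two of them in perpendicular directions are in general position with `a`.
  set s := Real.tanh (r / 4) with hs
  have hs0 : 0 < s := by
    rw [hs, Real.tanh_eq_sinh_div_cosh]
    exact div_pos (Real.sinh_pos_iff.2 (by positivity)) (Real.cosh_pos _)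
  have hs1 : s < 1 := Real.tanh_lt_one _
  have key : ∀ z, ‖poincareDisk a z‖ = s → z ∈ U := by
    intro z hz
    apply hrU
    rw [Metric.mem_ball, dist_comm]
    have h1 := norm_poincareDisk_sq a z
    rw [hz] at h1
    have h2 : halfSinh a z = Real.sinh (r / 4) := by
      rw [← sq_eq_sq₀ (halfSinh_nonneg _ _) (Real.sinh_nonneg_iff.2 (by positivity))]
      have h3 : s ^ 2 = Real.sinh (r / 4) ^ 2 / (1 + Real.sinh (r / 4) ^ 2) := by
        rw [hs, Real.tanh_eq_sinh_div_cosh, div_pow, Real.cosh_sq']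
      rw [h3, div_eq_div_iff (by positivity) (by positivity)] at h1
      linarith
    have := Real.sinh_injective h2
    linarith
  obtain ⟨b, hb⟩ := exists_poincareDisk_eq a (w := (s : ℂ)) (by simpa [abs_of_pos hs0] using hs1)
  obtain ⟨c, hc⟩ := exists_poincareDisk_eq a (w := s * Complex.I)
    (by simpa [abs_of_pos hs0] using hs1)
  refine IsometryEquiv.ext_of_hypSide_ne_zero (a := a) (b := b) (c := c) ?_
    (h (mem_of_mem_nhds hU)) (h (key b ?_)) (h (key c ?_))
  · rw [hypSide, hb, hc, lineSide_eq]
    simp [hs0.ne']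
  · simp [hb, abs_of_pos hs0]
  · simp [hc, abs_of_pos hs0]

end DiskModel

/-! ### Overlapping triangles and the circumscribing angle. -/

section Triangles

open Complex

/-- The numerator is the discriminant in `IsSideTriple`; this ties the position of the vertices to
nondegeneracy of the side lengths. -/
theorem hypSide_sq (a b c : UpperHalfPlane) :
    hypSide a b c ^ 2 = (4 * halfSinh a c ^ 2 * halfSinh a b ^ 2
      - (halfSinh a c ^ 2 + halfSinh a b ^ 2 - halfSinh b c ^ 2) ^ 2
      + 4 * halfSinh b c ^ 2 * halfSinh a c ^ 2 * halfSinh a b ^ 2)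
      / (4 * (1 + halfSinh a b ^ 2) ^ 2 * (1 + halfSinh a c ^ 2) ^ 2) := by
  have h := inner_sq_add_lineSide_sq (poincareDisk a b) (poincareDisk a c)
  rw [inner_poincareDisk, norm_poincareDisk_sq, norm_poincareDisk_sq] at h
  have e := eq_sub_of_add_eq' h
  rw [hypSide, e]
  have h1 : 0 < 1 + halfSinh a b ^ 2 := by positivity
  have h2 : 0 < 1 + halfSinh a c ^ 2 := by positivity
  field_simp
  ring

theorem ne_of_hypSide_ne_zero {a b c : UpperHalfPlane} (h : hypSide a b c ≠ 0) :
    a ≠ b ∧ a ≠ c ∧ b ≠ c := by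
  refine ⟨?_, ?_, ?_⟩ <;> rintro rfl <;> apply h <;> rw [hypSide, lineSide_eq]
  · simp [poincareDisk_self]
  · simp [poincareDisk_self]
  · ring

theorem isSideTriple_of_hypSide_ne_zero {a b c : UpperHalfPlane} (h : hypSide a b c ≠ 0) :
    IsSideTriple (halfSinh b c) (halfSinh a c) (halfSinh a b) := by
  obtain ⟨h1, h2, h3⟩ := ne_of_hypSide_ne_zero h
  refine ⟨halfSinh_pos h3, halfSinh_pos h2, halfSinh_pos h1, ?_⟩
  have e := hypSide_sq a b c
  have hpos : 0 < hypSide a b c ^ 2 := by positivity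
  rw [e] at hpos
  exact (div_pos_iff_of_pos_right (by positivity)).1 hpos

/-- Equality in the triangle inequality expresses `halfSinh a b` by the addition formula for `sinh`,
and the discriminant then vanishes identically. -/
theorem hypSide_eq_zero_of_mem_hypSegment {a b z : UpperHalfPlane} (h : z ∈ hypSegment a b) :
    hypSide a b z = 0 := by
  rw [← sq_eq_zero_iff, hypSide_sq]
  have h' : dist a z + dist z b = dist a b := h
  have e : halfSinh a b = halfSinh a z * Real.cosh (dist z b / 2)
      + Real.cosh (dist a z / 2) * halfSinh b z := by
    rw [halfSinh_comm b z, halfSinh, halfSinh, halfSinh, ← Real.sinh_add, ← h']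
    ring_nf
  have e1 := Real.cosh_sq (dist a z / 2)
  have e2 := Real.cosh_sq (dist z b / 2)
  rw [← halfSinh] at e1 e2
  rw [halfSinh_comm z b] at e2
  set p := Real.cosh (dist a z / 2)
  set q := Real.cosh (dist z b / 2)
  set A := halfSinh a z
  set B := halfSinh b z
  have hA : A ^ 2 = p ^ 2 - 1 := by linarith
  have hB : B ^ 2 = q ^ 2 - 1 := by linarith
  have e3 : halfSinh a b ^ 2 = A ^ 2 * q ^ 2 + p ^ 2 * B ^ 2 + 2 * (A * B) * (p * q) := by
    rw [e]; ring
  have key : 4 * A ^ 2 * halfSinh a b ^ 2 - (A ^ 2 + halfSinh a b ^ 2 - B ^ 2) ^ 2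
      + 4 * B ^ 2 * A ^ 2 * halfSinh a b ^ 2 = 0 := by
    rw [e3]
    have hAB : (A * B) ^ 2 = (p ^ 2 - 1) * (q ^ 2 - 1) := by rw [mul_pow, hA, hB]
    rw [hA, hB]
    generalize A * B = m at hAB ⊢
    linear_combination (-4 * p ^ 2 * q ^ 2) * hAB
  rw [key, zero_div]

/-- The determinant which decides on which side of the geodesic through `a` and `b` the point `c`
lies, in the coordinates `(x, x ^ 2 + y ^ 2)` in which geodesics are straight. -/
noncomputable def hypDet (a b c : UpperHalfPlane) : ℝ :=
  (c.re - a.re) * (b.re ^ 2 + b.im ^ 2 - (a.re ^ 2 + a.im ^ 2))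
    - (b.re - a.re) * (c.re ^ 2 + c.im ^ 2 - (a.re ^ 2 + a.im ^ 2))

theorem hypSide_eq (a b c : UpperHalfPlane) :
    hypSide a b c = -(2 * a.im) / (normSq ((b : ℂ) - (starRingEnd ℂ) (a : ℂ)) *
      normSq ((c : ℂ) - (starRingEnd ℂ) (a : ℂ))) * hypDet a b c := by
  have e : (starRingEnd ℂ) (poincareDisk a b) * poincareDisk a c =
      ((starRingEnd ℂ) ((b : ℂ) - a) * ((b : ℂ) - (starRingEnd ℂ) (a : ℂ)) * (((c : ℂ) - a) *
        (starRingEnd ℂ) ((c : ℂ) - (starRingEnd ℂ) (a : ℂ)))) *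
      (((normSq ((b : ℂ) - (starRingEnd ℂ) (a : ℂ)) *
      normSq ((c : ℂ) - (starRingEnd ℂ) (a : ℂ)))⁻¹ : ℝ) : ℂ) := by
    rw [poincareDisk, poincareDisk, div_eq_mul_inv, div_eq_mul_inv, Complex.inv_def,
      Complex.inv_def]
    simp only [map_mul, map_sub, conj_conj, Complex.conj_ofReal, ofReal_mul, mul_inv]
    ring
  rw [hypSide, lineSide, e, Complex.im_mul_ofReal, div_mul_eq_mul_div, div_eq_mul_inv]
  congr 1
  simp [hypDet]
  ring

theorem hypSide_mul_pos_iff (a b c d : UpperHalfPlane) :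
    0 < hypSide a b c * hypSide a b d ↔ 0 < hypDet a b c * hypDet a b d := by
  have hb := normSq_pos.2 (sub_conj_ne_zero a b)
  have hc := normSq_pos.2 (sub_conj_ne_zero a c)
  have hd := normSq_pos.2 (sub_conj_ne_zero a d)
  have ha := a.im_pos
  have e : hypSide a b c * hypSide a b d =
      (4 * a.im ^ 2 / (normSq ((b : ℂ) - (starRingEnd ℂ) (a : ℂ)) ^ 2 *
      normSq ((c : ℂ) - (starRingEnd ℂ) (a : ℂ)) * normSq ((d : ℂ) - (starRingEnd ℂ) (a : ℂ)))) *
      (hypDet a b c * hypDet a b d) := by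
    rw [hypSide_eq, hypSide_eq]
    field_simp
    ring
  rw [e]
  exact mul_pos_iff_of_pos_left (by positivity)

theorem hypSide_ne_zero_iff (a b c : UpperHalfPlane) : hypSide a b c ≠ 0 ↔ hypDet a b c ≠ 0 := by
  rw [← mul_self_pos, hypSide_mul_pos_iff, mul_self_pos]

/-- Geodesic segments are straight in the coordinates `(x, x ^ 2 + y ^ 2)`. -/
theorem mem_hypSegment_of_affine {b c z : UpperHalfPlane} {r : ℝ} (h0 : 0 ≤ r) (h1 : r ≤ 1)
    (hre : z.re = (1 - r) * b.re + r * c.re)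
    (hsq : z.re ^ 2 + z.im ^ 2 = (1 - r) * (b.re ^ 2 + b.im ^ 2) + r * (c.re ^ 2 + c.im ^ 2)) :
    z ∈ hypSegment b c := by
  have hb := b.im_pos
  have hc := c.im_pos
  have hz := z.im_pos
  have e1 := UpperHalfPlane.cosh_dist' b z
  have e2 := UpperHalfPlane.cosh_dist' z c
  have e3 := UpperHalfPlane.cosh_dist' b c
  -- In the hyperboloid model a point `x + i y` is the vector `(1, x, x ^ 2 + y ^ 2) / y`, and `z`
  -- is `l` times the vector of `b` plus `m` times that of `c`. Pairing with `b`, with `c` and with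
  -- `z` itself gives `f1`, `f2` and `f3`.
  set l := (1 - r) * b.im / z.im with hl
  set m := r * c.im / z.im with hm
  set C := Real.cosh (dist b c) with hC
  have hl0 : 0 ≤ l := div_nonneg (mul_nonneg (by linarith) hb.le) hz.le
  have hm0 : 0 ≤ m := by positivity
  have hzz : z.im ^ 2 = (1 - r) * (b.re ^ 2 + b.im ^ 2) + r * (c.re ^ 2 + c.im ^ 2) - z.re ^ 2 := by
    linarith
  have f1 : Real.cosh (dist b z) = l + m * C := by
    rw [e1, e3, hl, hm]
    field_simp
    rw [hzz, hre]
    ring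
  have f2 : Real.cosh (dist z c) = l * C + m := by
    rw [e2, e3, hl, hm]
    field_simp
    rw [hzz, hre]
    ring
  have f3 : l ^ 2 + m ^ 2 + 2 * (l * m) * C = 1 := by
    rw [e3, hl, hm]
    field_simp
    rw [hzz, hre]
    ring
  have hS := Real.sinh_sq (dist b c)
  rw [← hC] at hS
  have hS0 : 0 ≤ Real.sinh (dist b c) := Real.sinh_nonneg_iff.2 dist_nonneg
  have g1 : Real.sinh (dist b z) = m * Real.sinh (dist b c) := by
    rw [← sq_eq_sq₀ (Real.sinh_nonneg_iff.2 dist_nonneg) (by positivity), Real.sinh_sq, mul_pow,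
      hS, f1]
    linear_combination f3
  have g2 : Real.sinh (dist z c) = l * Real.sinh (dist b c) := by
    rw [← sq_eq_sq₀ (Real.sinh_nonneg_iff.2 dist_nonneg) (by positivity), Real.sinh_sq, mul_pow,
      hS, f2]
    linear_combination f3
  have key : Real.cosh (dist b z + dist z c) = Real.cosh (dist b c) := by
    rw [Real.cosh_add, f1, f2, g1, g2, ← hC]
    linear_combination C * f3 + l * m * hS
  exact Real.cosh_strictMonoOn.injOn (Set.mem_Ici.2 (by positivity)) (Set.mem_Ici.2 dist_nonneg) key

theorem exists_affine_combination (b c : UpperHalfPlane) {r : ℝ} (h0 : 0 ≤ r) (h1 : r ≤ 1) :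
    ∃ z : UpperHalfPlane, z.re = (1 - r) * b.re + r * c.re ∧
      z.re ^ 2 + z.im ^ 2 = (1 - r) * (b.re ^ 2 + b.im ^ 2) + r * (c.re ^ 2 + c.im ^ 2) := by
  set s := (1 - r) * b.re + r * c.re with hs
  set t := (1 - r) * (b.re ^ 2 + b.im ^ 2) + r * (c.re ^ 2 + c.im ^ 2) with ht
  have hpos : 0 < t - s ^ 2 := by
    have e : t - s ^ 2 = (1 - r) * b.im ^ 2 + r * c.im ^ 2 + r * (1 - r) * (b.re - c.re) ^ 2 := by
      rw [hs, ht]; ring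
    have hb := b.im_pos
    have hc := c.im_pos
    rw [e]
    have h3 : 0 ≤ r * (1 - r) * (b.re - c.re) ^ 2 :=
      mul_nonneg (mul_nonneg h0 (by linarith)) (sq_nonneg _)
    rcases h0.eq_or_lt with h | h
    · rw [← h]; simp; positivity
    · have : 0 ≤ (1 - r) * b.im ^ 2 := mul_nonneg (by linarith) (sq_nonneg _)
      positivity
  refine ⟨⟨⟨s, √(t - s ^ 2)⟩, Real.sqrt_pos.2 hpos⟩, rfl, ?_⟩
  change s ^ 2 + √(t - s ^ 2) ^ 2 = t
  rw [Real.sq_sqrt hpos.le]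
  ring

theorem mem_hypTriangle_of_affine {a b c z : UpperHalfPlane} {r s : ℝ} (hr0 : 0 ≤ r) (hr1 : r ≤ 1)
    (hs0 : 0 ≤ s) (hs1 : s ≤ 1)
    (hre : z.re = (1 - s) * a.re + s * ((1 - r) * b.re + r * c.re))
    (hsq : z.re ^ 2 + z.im ^ 2 = (1 - s) * (a.re ^ 2 + a.im ^ 2)
      + s * ((1 - r) * (b.re ^ 2 + b.im ^ 2) + r * (c.re ^ 2 + c.im ^ 2))) :
    z ∈ hypTriangle a b c := by
  obtain ⟨y, hy1, hy2⟩ := exists_affine_combination b c hr0 hr1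
  refine Set.mem_biUnion (mem_hypSegment_of_affine hr0 hr1 hy1 hy2)
    (mem_hypSegment_of_affine hs0 hs1 ?_ ?_)
  · rw [hre, hy1]
  · rw [hsq, hy2]

/-- Two triangles on the same side of a common edge overlap near each of its vertices. -/
theorem exists_mem_hypTriangle_inter {a b c d : UpperHalfPlane}
    (h : 0 < hypSide a b c * hypSide a b d) {U : Set UpperHalfPlane} (hU : U ∈ nhds a) :
    ∃ z ∈ U, z ∈ hypTriangle a b c ∧ z ∈ hypTriangle a b d ∧ z ∉ hypSegment a b := by
  rw [hypSide_mul_pos_iff] at h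
  have hc : hypDet a b c ≠ 0 := fun h0 => by simp [h0] at h
  -- In the straight coordinates, `d - a = k * (b - a) + g * (c - a)`. The two triangles lie on the
  -- same side exactly because `g` is positive.
  set g := hypDet a b d / hypDet a b c with hg
  have hg0 : 0 < g := by
    rw [hg, ← mul_div_mul_left _ _ hc]
    exact div_pos h (mul_self_pos.2 hc)
  set k := ((d.re - a.re) * (c.re ^ 2 + c.im ^ 2 - (a.re ^ 2 + a.im ^ 2))
    - (c.re - a.re) * (d.re ^ 2 + d.im ^ 2 - (a.re ^ 2 + a.im ^ 2))) / (-hypDet a b c) with hk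
  have d1 : d.re - a.re = k * (b.re - a.re) + g * (c.re - a.re) := by
    rw [hk, hg, div_neg]
    field_simp
    simp only [hypDet]
    ring
  have d2 : d.re ^ 2 + d.im ^ 2 - (a.re ^ 2 + a.im ^ 2) =
      k * (b.re ^ 2 + b.im ^ 2 - (a.re ^ 2 + a.im ^ 2))
        + g * (c.re ^ 2 + c.im ^ 2 - (a.re ^ 2 + a.im ^ 2)) := by
    rw [hk, hg, div_neg]
    field_simp
    simp only [hypDet]
    ring
  -- The point `(1 - r) b + r d` of the side `b d` is taken so close to `b` that both of its
  -- coordinates along `b - a` and `c - a` are positive; `n` is their sum. A short move from `a`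
  -- towards it, of parameter `s`, stays in both triangles and leaves the edge.
  obtain ⟨r, hr0, hr1, hr⟩ : ∃ r : ℝ, 0 < r ∧ r ≤ 1 ∧ 0 < 1 - r + r * k := by
    refine ⟨1 / (2 + |k|), by positivity, ?_, ?_⟩
    · rw [div_le_one (by positivity)]; linarith [abs_nonneg k]
    · have e : 1 - 1 / (2 + |k|) + 1 / (2 + |k|) * k = (1 + |k| + k) / (2 + |k|) := by
        have : 0 < 2 + |k| := by positivity
        field_simp; ring
      rw [e]
      have := neg_abs_le k
      apply div_pos <;> linarith [abs_nonneg k]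
  set n := 1 - r + r * k + r * g with hn
  have hn0 : 0 < n := by positivity
  have hcont : Filter.Tendsto (fun s : ℝ => (⟨(1 - s) * a.re + s * ((1 - r) * b.re + r * d.re),
      √((1 - s) * (a.re ^ 2 + a.im ^ 2)
      + s * ((1 - r) * (b.re ^ 2 + b.im ^ 2) + r * (d.re ^ 2 + d.im ^ 2)) -
      ((1 - s) * a.re + s * ((1 - r) * b.re + r * d.re)) ^ 2)⟩ : ℂ)) (nhds 0) (nhds (a : ℂ)) := by
    have e : (a : ℂ) = (fun s : ℝ => (⟨(1 - s) * a.re + s * ((1 - r) * b.re + r * d.re),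
      √((1 - s) * (a.re ^ 2 + a.im ^ 2)
      + s * ((1 - r) * (b.re ^ 2 + b.im ^ 2) + r * (d.re ^ 2 + d.im ^ 2)) -
      ((1 - s) * a.re + s * ((1 - r) * b.re + r * d.re)) ^ 2)⟩ : ℂ)) 0 := by
      apply Complex.ext
      · simp
      · simp [Real.sqrt_sq a.im_pos.le]
    rw [e]
    apply Continuous.tendsto
    rw [show (fun s : ℝ => (⟨(1 - s) * a.re + s * ((1 - r) * b.re + r * d.re),
      √((1 - s) * (a.re ^ 2 + a.im ^ 2)
      + s * ((1 - r) * (b.re ^ 2 + b.im ^ 2) + r * (d.re ^ 2 + d.im ^ 2)) -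
      ((1 - s) * a.re + s * ((1 - r) * b.re + r * d.re)) ^ 2)⟩ : ℂ)) = fun s : ℝ =>
        Complex.equivRealProdCLM.symm ((1 - s) * a.re + s * ((1 - r) * b.re + r * d.re),
      √((1 - s) * (a.re ^ 2 + a.im ^ 2)
      + s * ((1 - r) * (b.re ^ 2 + b.im ^ 2) + r * (d.re ^ 2 + d.im ^ 2)) -
      ((1 - s) * a.re + s * ((1 - r) * b.re + r * d.re)) ^ 2)) from rfl]
    fun_prop
  have hev := hcont.eventually_mem (UpperHalfPlane.isOpenEmbedding_coe.image_mem_nhds.2 hU)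
  have hev2 : ∀ᶠ s : ℝ in nhds 0, s * n < 1 ∧ s < 1 := by
    refine ContinuousAt.eventually_lt (f := fun s : ℝ => s * n) (by fun_prop) (by fun_prop)
      (by simp) |>.and (eventually_lt_nhds zero_lt_one)
  obtain ⟨s, ⟨hs1, hs2, hs3⟩, hs0⟩ := ((hev.and hev2).filter_mono
    (nhdsWithin_le_nhds (s := Set.Ioi (0 : ℝ)))).and self_mem_nhdsWithin |>.exists
  obtain ⟨z, hzU, hz⟩ := hs1
  have hs0 : 0 < s := hs0
  have z1 : z.re = (1 - s) * a.re + s * ((1 - r) * b.re + r * d.re) := by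
    rw [← UpperHalfPlane.coe_re, hz]
  have z2 : z.re ^ 2 + z.im ^ 2 = (1 - s) * (a.re ^ 2 + a.im ^ 2)
      + s * ((1 - r) * (b.re ^ 2 + b.im ^ 2) + r * (d.re ^ 2 + d.im ^ 2)) := by
    have him : z.im = √((1 - s) * (a.re ^ 2 + a.im ^ 2)
      + s * ((1 - r) * (b.re ^ 2 + b.im ^ 2) + r * (d.re ^ 2 + d.im ^ 2)) - z.re ^ 2) := by
      rw [z1, ← UpperHalfPlane.coe_im, hz]
    have hp := Real.sqrt_pos.1 (him ▸ z.im_pos)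
    rw [him, Real.sq_sqrt hp.le]
    ring
  refine ⟨z, hzU, ?_, mem_hypTriangle_of_affine hr0.le hr1 hs0.le hs3.le z1 z2, ?_⟩
  · refine mem_hypTriangle_of_affine (r := r * g / n) (s := s * n) (by positivity) ?_
      (by positivity) hs2.le ?_ ?_
    · rw [div_le_one hn0]; linarith
    · rw [z1]
      field_simp
      rw [hn]
      linear_combination s * r * d1
    · rw [z2]
      field_simp
      rw [hn]
      linear_combination s * r * d2
  · intro hmem
    have h0 := hypSide_eq_zero_of_mem_hypSegment hmem
    rw [← not_ne_iff, hypSide_ne_zero_iff] at h0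
    apply h0
    have e : hypDet a b z = s * r * g * hypDet a b c := by
      unfold hypDet
      rw [z2, z1]
      linear_combination s * r * (b.re ^ 2 + b.im ^ 2 - (a.re ^ 2 + a.im ^ 2)) * d1
        - s * r * (b.re - a.re) * d2
    rw [e]
    have := hg0.ne'
    have := hr0.ne'
    have := hs0.ne'
    positivity

/-- The tangent-chord theorem: the angle between the chord from `0` to `u` and the tangent at `0`
equals the inscribed angle at `v`, whose cosine is the inner product of `v` and `v - u` over the
product of their norms. -/
theorem arccos_angle_eq {u v o τ : ℂ} (h1 : ‖u - o‖ = ‖o‖) (h2 : ‖v - o‖ = ‖o‖)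
    (h3 : (inner ℝ τ o : ℝ) = 0) (h4 : 0 < lineSide u τ * lineSide u v) :
    InnerProductGeometry.angle τ (-u) =
      Real.arccos ((‖v‖ ^ 2 - inner ℝ u v) / (‖v‖ * ‖u - v‖)) := by
  have hq : lineSide u v ≠ 0 := fun h => by simp [h] at h4
  have hp : lineSide u τ ≠ 0 := fun h => by simp [h] at h4
  have hpq : 0 < lineSide u τ / lineSide u v := by
    rw [← mul_div_mul_right _ _ hq]
    exact div_pos h4 (mul_self_pos.2 hq)
  have k1 : ‖u‖ ^ 2 = 2 * inner ℝ u o := by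
    have := norm_sub_sq_real u o
    rw [h1] at this; linarith
  have k2 : ‖v‖ ^ 2 = 2 * inner ℝ v o := by
    have := norm_sub_sq_real v o
    rw [h2] at this; linarith
  have hu : 0 < ‖u‖ ^ 2 := by
    have : u ≠ 0 := fun h => hq (by simp [h, lineSide])
    positivity
  set N := ‖v‖ ^ 2 - inner ℝ u v with hN
  -- Eliminating the centre `o`, which is orthogonal to `τ` and pairs with `u` and `v` to half of
  -- their squared norms.
  have m1 : lineSide u v * inner ℝ u τ = -(lineSide u τ * N) := by
    have a1 := lineSide_mul_lineSide u τ o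
    have a2 := lineSide_mul_lineSide u v o
    apply mul_left_cancel₀ hu.ne'
    rw [h3, mul_zero, zero_sub] at a1
    rw [hN]
    linear_combination (lineSide u v * inner ℝ u τ - lineSide u τ * inner ℝ u v) * k1
      + (lineSide u τ * ‖u‖ ^ 2) * k2 + (2 * lineSide u v) * a1 - (2 * lineSide u τ) * a2
  have m2 : ‖u‖ * ‖τ‖ = lineSide u τ / lineSide u v * (‖v‖ * ‖u - v‖) := by
    rw [← sq_eq_sq₀ (by positivity) (by positivity), mul_pow, ← inner_sq_add_lineSide_sq, mul_pow,
      mul_pow, ← inner_sq_add_lineSide_sq v (u - v), inner_sub_right, real_inner_self_eq_norm_sq]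
    have e : lineSide v (u - v) = -lineSide u v := by
      simp only [lineSide_eq, Complex.sub_re, Complex.sub_im]; ring
    rw [e]
    field_simp
    rw [real_inner_comm u v]
    linear_combination (lineSide u v * inner ℝ u τ - lineSide u τ * N) * m1
  have m3 : (inner ℝ u τ : ℝ) = -(lineSide u τ / lineSide u v * N) := by
    field_simp
    linear_combination m1
  rw [InnerProductGeometry.angle, inner_neg_right, norm_neg, real_inner_comm, m3, neg_neg,
    mul_comm ‖τ‖, m2, mul_div_mul_left _ _ hpq.ne']

/-- The circumscribing angle of a triangle in terms of its side lengths. -/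
theorem IsCircumscribedAngle.eq_circumAngle {a b c : UpperHalfPlane} {θ : ℝ}
    (h : IsCircumscribedAngle a b c θ) :
    hypSide a b c ≠ 0 ∧ θ = circumAngle (halfSinh b c) (halfSinh a c) (halfSinh a b) := by
  obtain ⟨o, τ, h1, h2, -, h3, h4, h5⟩ := h
  have hs : hypSide a b c ≠ 0 := fun h0 => by
    rw [hypSide] at h0
    simp [h0] at h4
  refine ⟨hs, ?_⟩
  rw [h5, arccos_angle_eq h1 h2 h3 h4, circumAngle]
  obtain ⟨p1, p2, p3, -⟩ := isSideTriple_of_hypSide_ne_zero hs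
  congr 1
  have hz : 0 < √(1 + halfSinh a b ^ 2) := Real.sqrt_pos.2 (by positivity)
  have hzz := Real.sq_sqrt (by positivity : 0 ≤ 1 + halfSinh a b ^ 2)
  have e : ‖poincareDisk a c‖ * ‖poincareDisk a b - poincareDisk a c‖ =
      halfSinh b c * halfSinh a c / ((1 + halfSinh a c ^ 2) * √(1 + halfSinh a b ^ 2)) := by
    rw [← sq_eq_sq₀ (by positivity) (by positivity), mul_pow, norm_poincareDisk_sub_sq,
      one_sub_norm_poincareDisk_sq', one_sub_norm_poincareDisk_sq', norm_poincareDisk_sq, div_pow,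
      mul_pow, mul_pow, hzz]
    field_simp
  have e2 : ‖poincareDisk a c‖ ^ 2 - inner ℝ (poincareDisk a b) (poincareDisk a c) =
      (halfSinh b c ^ 2 + halfSinh a c ^ 2 - halfSinh a b ^ 2) /
        (2 * (1 + halfSinh a c ^ 2) * √(1 + halfSinh a b ^ 2) ^ 2) := by
    rw [hzz, norm_poincareDisk_sq, inner_poincareDisk]
    field_simp
    ring
  rw [e, e2]
  field_simp

end Triangles

open Filter Topology Manifold

/-! ### Local isometries between hyperbolic surfaces. -/

section Charts

theorem isometryEquiv_eq_of_eventuallyEq {G : Type*} [TopologicalSpace G]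
    {φ : OpenPartialHomeomorph G UpperHalfPlane} {y : G} (h : y ∈ φ.source) {g k : UpperHalfPlane ≃ᵢ UpperHalfPlane}
    (hgk : ∀ᶠ z in 𝓝 y, g (φ z) = k (φ z)) : g = k := by
  have h' : ∀ᶠ z in 𝓝 (φ y), g z = k z := by
    rw [← φ.map_nhds_eq h]
    exact eventually_map.2 hgk
  exact IsometryEquiv.eq_of_eqOn_nhds (U := {z | g z = k z}) h' fun z hz => hz

variable {G : Type*} [TopologicalSpace G] [ChartedSpace UpperHalfPlane G]

theorem exists_isometryEquiv_eventuallyEq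
    {φ ψ : OpenPartialHomeomorph G UpperHalfPlane} (hφ : φ ∈ hypGroupoid.maximalAtlas G)
    (hψ : ψ ∈ hypGroupoid.maximalAtlas G) {y : G} (h1 : y ∈ φ.source) (h2 : y ∈ ψ.source) :
    ∃ g : UpperHalfPlane ≃ᵢ UpperHalfPlane, ∀ᶠ z in 𝓝 y, ψ z = g (φ z) := by
  have h := (hypGroupoid.compatible_of_mem_maximalAtlas hφ hψ).1
  have hs : φ y ∈ (φ.symm ≫ₕ ψ).source := by
    rw [OpenPartialHomeomorph.trans_source]
    exact ⟨φ.map_source h1, by simpa [φ.left_inv h1] using h2⟩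
  obtain ⟨U, hU, hyU, g, hg⟩ := h _ hs
  refine ⟨g, ?_⟩
  filter_upwards [φ.open_source.mem_nhds h1, ψ.open_source.mem_nhds h2,
    (φ.continuousAt h1).preimage_mem_nhds (hU.mem_nhds hyU)] with z hz1 hz2 hz3
  have := hg (x := φ z) ⟨by
    rw [OpenPartialHomeomorph.trans_source]
    exact ⟨φ.map_source hz1, by simpa [φ.left_inv hz1] using hz2⟩, hz3⟩
  simpa [φ.left_inv hz1] using this

/-- The transition between two charts is a single isometry along a connected set. -/
theorem exists_isometryEquiv_of_isPreconnected
    {φ ψ : OpenPartialHomeomorph G UpperHalfPlane} (hφ : φ ∈ hypGroupoid.maximalAtlas G)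
    (hψ : ψ ∈ hypGroupoid.maximalAtlas G) {K : Set G} (hK : IsPreconnected K)
    (h1 : K ⊆ φ.source) (h2 : K ⊆ ψ.source) :
    ∃ g : UpperHalfPlane ≃ᵢ UpperHalfPlane, ∀ y ∈ K, ∀ᶠ z in 𝓝 y, ψ z = g (φ z) := by
  rcases K.eq_empty_or_nonempty with rfl | ⟨y, hy⟩
  · exact ⟨IsometryEquiv.refl _, fun y hy => hy.elim⟩
  obtain ⟨g, hg⟩ := exists_isometryEquiv_eventuallyEq hφ hψ (h1 hy) (h2 hy)
  refine ⟨g, fun z hz => ?_⟩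
  have hopen : ∀ k : UpperHalfPlane ≃ᵢ UpperHalfPlane,
      IsOpen {z | z ∈ φ.source ∧ ∀ᶠ w in 𝓝 z, ψ w = k (φ w)} := fun k =>
    φ.open_source.inter isOpen_setOfPred_eventually_nhds
  -- The set where the transition is `g` and the union of those where it is another isometry are
  -- open and disjoint, and together cover `K`.
  have hsub := IsPreconnected.subset_left_of_subset_union (s := K) (hopen g)
    (isOpen_biUnion fun (k : UpperHalfPlane ≃ᵢ UpperHalfPlane) (_ : k ≠ g) => hopen k) ?_ ?_
    ⟨y, hy, h1 hy, hg⟩ hK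
  · exact (hsub hz).2
  · rw [Set.disjoint_left]
    rintro w ⟨hw, hw1⟩ hw2
    obtain ⟨k, hk, -, hw3⟩ := Set.mem_iUnion₂.1 hw2
    refine hk (isometryEquiv_eq_of_eventuallyEq hw ?_)
    filter_upwards [hw1, hw3] with v e1 e2
    rw [← e1, ← e2]
  · intro w hw
    obtain ⟨k, hk⟩ := exists_isometryEquiv_eventuallyEq hφ hψ (h1 hw) (h2 hw)
    by_cases hkg : k = g
    · exact Or.inl ⟨h1 hw, hkg ▸ hk⟩
    · exact Or.inr (Set.mem_iUnion₂.2 ⟨k, hkg, h1 hw, hk⟩)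

variable {G' : Type*} [TopologicalSpace G'] [ChartedSpace UpperHalfPlane G']

/-- The map `h` is an isometry of hyperbolic surfaces near `y`. -/
def IsSurfaceIsometryAt (h : G → G') (y : G) : Prop :=
  ∃ φ ∈ hypGroupoid.maximalAtlas G, ∃ ψ ∈ hypGroupoid.maximalAtlas G',
    y ∈ φ.source ∧ h y ∈ ψ.source ∧
      ∃ m : UpperHalfPlane ≃ᵢ UpperHalfPlane, ∀ᶠ z in 𝓝 y, ψ (h z) = m (φ z)

theorem IsSurfaceIsometryAt.symm {h : G ≃ₜ G'} {y : G} (H : IsSurfaceIsometryAt h y) :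
    IsSurfaceIsometryAt h.symm (h y) := by
  obtain ⟨φ, hφ, ψ, hψ, h1, h2, m, hm⟩ := H
  refine ⟨ψ, hψ, φ, hφ, h2, by simpa using h1, m.symm, ?_⟩
  have ht : Tendsto h.symm (𝓝 (h y)) (𝓝 y) := by
    simpa using h.symm.continuous.tendsto (h y)
  filter_upwards [ht.eventually hm] with z hz
  apply m.injective
  rw [m.apply_symm_apply, ← hz, h.apply_symm_apply]

theorem IsSurfaceIsometryAt.isLocallyHypIsometry [HasGroupoid G hypGroupoid]
    [HasGroupoid G' hypGroupoid] {h : G ≃ₜ G'} (H : ∀ y, IsSurfaceIsometryAt h y)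
    {c : OpenPartialHomeomorph G UpperHalfPlane} {c' : OpenPartialHomeomorph G' UpperHalfPlane}
    (hc : c ∈ atlas UpperHalfPlane G) (hc' : c' ∈ atlas UpperHalfPlane G') :
    IsLocallyHypIsometry (c.symm ≫ₕ h.toOpenPartialHomeomorph ≫ₕ c')
      (c.symm ≫ₕ h.toOpenPartialHomeomorph ≫ₕ c').source := by
  intro x hx
  have hx1 : x ∈ c.target := by
    rw [OpenPartialHomeomorph.trans_source] at hx
    exact hx.1
  have hx2 : h (c.symm x) ∈ c'.source := by
    simpa [OpenPartialHomeomorph.trans_source] using hx.2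
  obtain ⟨φ, hφ, ψ, hψ, h1, h2, m, hm⟩ := H (c.symm x)
  obtain ⟨g, hg⟩ := exists_isometryEquiv_eventuallyEq (hypGroupoid.subset_maximalAtlas hc) hφ
    (c.map_target hx1) h1
  obtain ⟨k, hk⟩ := exists_isometryEquiv_eventuallyEq hψ (hypGroupoid.subset_maximalAtlas hc') h2
    hx2
  have ht := c.continuousAt_symm hx1
  have ht2 : Tendsto (fun z => h (c.symm z)) (𝓝 x) (𝓝 (h (c.symm x))) :=
    (h.continuous.tendsto _).comp ht
  have hev : ∀ᶠ z in 𝓝 x, c' (h (c.symm z)) = k (m (g z)) := by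
    filter_upwards [ht.eventually hm, ht.eventually hg, ht2.eventually hk,
      c.open_target.mem_nhds hx1] with z e1 e2 e3 e4
    rw [e3, e1, e2, c.right_inv e4]
  obtain ⟨U, hU, hUo, hxU⟩ := eventually_nhds_iff.1 hev
  exact ⟨U, hUo, hxU, (g.trans m).trans k, fun z hz => hU z hz.2⟩

/-- A homeomorphism which is locally an isometry is an isometry of hyperbolic surfaces. -/
noncomputable def structomorphOfIsSurfaceIsometryAt [HasGroupoid G hypGroupoid]
    [HasGroupoid G' hypGroupoid] (h : G ≃ₜ G') (H : ∀ y, IsSurfaceIsometryAt h y) :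
    Structomorph hypGroupoid G G' where
  toHomeomorph := h
  mem_groupoid c c' hc hc' := by
    refine ⟨IsSurfaceIsometryAt.isLocallyHypIsometry H hc hc', ?_⟩
    have H' : ∀ y, IsSurfaceIsometryAt h.symm y := fun y => by
      simpa using (H (h.symm y)).symm
    have := IsSurfaceIsometryAt.isLocallyHypIsometry H' hc' hc
    have e : (c.symm ≫ₕ h.toOpenPartialHomeomorph ≫ₕ c').symm =
        c'.symm ≫ₕ h.symm.toOpenPartialHomeomorph ≫ₕ c := by
      rw [OpenPartialHomeomorph.trans_symm_eq_symm_trans_symm,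
        OpenPartialHomeomorph.trans_symm_eq_symm_trans_symm, OpenPartialHomeomorph.symm_symm,
        OpenPartialHomeomorph.trans_assoc]
      rfl
    rw [← OpenPartialHomeomorph.symm_source, e]
    exact this

end Charts

/-! ### Cells of a triangulation. -/

namespace SurfaceTriangulation

theorem exists_eq_insert_of_edge {V : Type*} {T : SurfaceTriangulation V} [DecidableEq V]
    {t e : Finset V} (ht : t ∈ T.faces)
    (he : e ⊆ t) (hc : e.card = 2) : ∃ a b c, a ≠ b ∧ b ≠ c ∧ c ≠ a ∧ e = {a, b} ∧ t = {a, b, c} := by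
  obtain ⟨a, b, hab, rfl⟩ := Finset.card_eq_two.1 hc
  have h3 := T.card_face t ht
  have h1 : (t \ {a, b}).card = 1 := by
    rw [Finset.card_sdiff_of_subset he, h3, hc]
  obtain ⟨c, hcs⟩ := Finset.card_eq_one.1 h1
  have hc' : c ∈ t \ {a, b} := by rw [hcs]; exact Finset.mem_singleton_self c
  rw [Finset.mem_sdiff, Finset.mem_insert, Finset.mem_singleton, not_or] at hc'
  refine ⟨a, b, c, hab, fun h => hc'.2.2 h.symm, hc'.2.1, rfl, ?_⟩
  rw [← Finset.sdiff_union_of_subset he, hcs]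
  ext v
  simp only [Finset.mem_union, Finset.mem_singleton, Finset.mem_insert]
  tauto

variable {V : Type*} [Fintype V] {T : SurfaceTriangulation V}

theorem exists_mem_cell_face (w : T.totalSpace) : ∃ t ∈ T.faces, w ∈ T.cell t := w.2.2

theorem cell_mono {s t : Finset V} (h : s ⊆ t) : T.cell s ⊆ T.cell t :=
  fun _ hw v hv => h (hw v hv)

theorem mem_cell_inter [DecidableEq V] {s t : Finset V} {w : T.totalSpace} (hs : w ∈ T.cell s)
    (ht : w ∈ T.cell t) : w ∈ T.cell (s ∩ t) :=
  fun v hv => Finset.mem_inter.2 ⟨hs v hv, ht v hv⟩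

theorem exists_ne_zero (w : T.totalSpace) : ∃ v, w.1 v ≠ 0 := by
  by_contra! h
  have := w.2.1.2
  simp [h] at this

theorem cell_empty : T.cell ∅ = ∅ := by
  ext w
  obtain ⟨v, hv⟩ := exists_ne_zero w
  exact ⟨fun h => absurd (h v hv) (Finset.notMem_empty v), fun h => h.elim⟩

theorem exists_mem_cell_singleton (T : SurfaceTriangulation V) (a : V) :
    ∃ w, w ∈ T.cell {a} := by
  classical
  obtain ⟨t, ht, hat⟩ := T.vertex_mem_face a
  refine ⟨⟨Pi.single a 1, single_mem_stdSimplex ℝ a, t, ht, ?_⟩, ?_⟩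
  · intro v hv
    by_cases h : v = a
    · exact h ▸ hat
    · simp [h] at hv
  · intro v hv
    by_contra h
    simp at h
    simp [h] at hv

/-- Cells are convex in barycentric coordinates. Connectedness lets a single transition isometry
serve a whole cell. -/
theorem isPreconnected_cell {s t : Finset V} (ht : t ∈ T.faces) (hst : s ⊆ t) :
    IsPreconnected (T.cell s) := by
  rw [← IsInducing.subtypeVal.isPreconnected_image]
  apply Convex.isPreconnected
  have e : Subtype.val '' T.cell s = {w | w ∈ stdSimplex ℝ V ∧ ∀ v, w v ≠ 0 → v ∈ s} := by
    ext w
    constructor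
    · rintro ⟨u, hu, rfl⟩
      exact ⟨u.2.1, hu⟩
    · rintro ⟨h1, h2⟩
      exact ⟨⟨w, h1, t, ht, fun v hv => hst (h2 v hv)⟩, h2, rfl⟩
  rw [e]
  intro u hu w hw p q hp hq hpq
  refine ⟨convex_stdSimplex ℝ V hu.1 hw.1 hp hq hpq, fun v hv => ?_⟩
  by_contra hvs
  have h1 : u v = 0 := by_contra fun h => hvs (hu.2 v h)
  have h2 : w v = 0 := by_contra fun h => hvs (hw.2 v h)
  simp [h1, h2] at hv

theorem isClosed_cell (s : Finset V) : IsClosed (T.cell s) := by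
  have e : T.cell s = ⋂ v : {v // v ∉ s}, {w : T.totalSpace | w.1 v = 0} := by
    ext w
    simp only [Set.mem_iInter, Subtype.forall]
    exact ⟨fun h v hv => by_contra fun hne => hv (h v hne),
      fun h v hv => by_contra fun hs => hv (h v hs)⟩
  rw [e]
  exact isClosed_iInter fun v => isClosed_eq
    ((continuous_apply v.1).comp continuous_subtype_val) continuous_const

end SurfaceTriangulation

theorem mem_hypSegment_apply_iff (g : UpperHalfPlane ≃ᵢ UpperHalfPlane) {a b z : UpperHalfPlane} :
    g z ∈ hypSegment (g a) (g b) ↔ z ∈ hypSegment a b := by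
  simp [hypSegment, g.dist_eq]

theorem mem_hypTriangle_apply {g : UpperHalfPlane ≃ᵢ UpperHalfPlane} {a b c z : UpperHalfPlane}
    (h : z ∈ hypTriangle a b c) : g z ∈ hypTriangle (g a) (g b) (g c) := by
  obtain ⟨y, hy, hz⟩ := Set.mem_iUnion₂.1 h
  exact Set.mem_iUnion₂.2
    ⟨g y, (mem_hypSegment_apply_iff g).2 hy, (mem_hypSegment_apply_iff g).2 hz⟩

theorem image_hypSegment (g : UpperHalfPlane ≃ᵢ UpperHalfPlane) (a b : UpperHalfPlane) :
    g '' hypSegment a b = hypSegment (g a) (g b) := by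
  ext z
  obtain ⟨y, rfl⟩ := g.surjective z
  rw [mem_hypSegment_apply_iff, g.injective.mem_set_image]

theorem image_hypTriangle (g : UpperHalfPlane ≃ᵢ UpperHalfPlane) (a b c : UpperHalfPlane) :
    g '' hypTriangle a b c = hypTriangle (g a) (g b) (g c) := by
  apply subset_antisymm
  · rintro _ ⟨z, hz, rfl⟩
    exact mem_hypTriangle_apply hz
  · intro z hz
    have := mem_hypTriangle_apply (g := g.symm) hz
    simp only [IsometryEquiv.symm_apply_apply] at this
    exact ⟨_, this, g.apply_symm_apply z⟩

theorem hypDet_swap (a b c : UpperHalfPlane) : hypDet a c b = -hypDet a b c := by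
  unfold hypDet; ring

theorem hypDet_rotate (a b c : UpperHalfPlane) : hypDet b c a = hypDet a b c := by
  unfold hypDet; ring

theorem hypSide_ne_zero_swap {a b c : UpperHalfPlane} (h : hypSide a b c ≠ 0) :
    hypSide a c b ≠ 0 := by
  rw [hypSide_ne_zero_iff] at h ⊢
  rwa [hypDet_swap, neg_ne_zero]

theorem hypSide_ne_zero_rotate {a b c : UpperHalfPlane} (h : hypSide a b c ≠ 0) :
    hypSide b c a ≠ 0 := by
  rw [hypSide_ne_zero_iff] at h ⊢
  rwa [hypDet_rotate]

/-! ### Comparison of face embeddings within one surface. -/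

namespace SurfaceTriangulation

variable {V : Type*} [Fintype V] {T : SurfaceTriangulation V}
variable {G : Type*} [TopologicalSpace G] [ChartedSpace UpperHalfPlane G]
variable {f : T.totalSpace ≃ₜ G}

namespace IsFaceEmbedding

variable {t s : Finset V} {φ ψ : OpenPartialHomeomorph G UpperHalfPlane} {x y : V → UpperHalfPlane}

theorem mem_source (h : T.IsFaceEmbedding f t φ x) {w : T.totalSpace} (hw : w ∈ T.cell t) :
    f w ∈ φ.source :=
  h.subset_source ⟨w, hw, rfl⟩

theorem apply_vertex (h : T.IsFaceEmbedding f t φ x) {a : V} (ha : a ∈ t) {w : T.totalSpace}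
    (hw : w ∈ T.cell {a}) : φ (f w) = x a := by
  have : φ (f w) ∈ φ '' (f '' T.cell {a}) := ⟨_, ⟨w, hw, rfl⟩, rfl⟩
  rw [h.image_vertex a ha] at this
  exact this

/-- Two face embeddings differ by a single isometry along a common cell. -/
theorem exists_transition (h : T.IsFaceEmbedding f t φ x) (h' : T.IsFaceEmbedding f s ψ y)
    (ht : t ∈ T.faces) {r : Finset V} (hrt : r ⊆ t) (hrs : r ⊆ s) :
    ∃ g : UpperHalfPlane ≃ᵢ UpperHalfPlane,
      (∀ w ∈ T.cell r, ∀ᶠ z in 𝓝 (f w), ψ z = g (φ z)) ∧ ∀ a ∈ r, y a = g (x a) := by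
  obtain ⟨g, hg⟩ := exists_isometryEquiv_of_isPreconnected h.mem_maximalAtlas h'.mem_maximalAtlas
    ((isPreconnected_cell ht hrt).image f f.continuous.continuousOn)
    ((Set.image_mono (cell_mono hrt)).trans h.subset_source)
    ((Set.image_mono (cell_mono hrs)).trans h'.subset_source)
  refine ⟨g, fun w hw => hg _ ⟨w, hw, rfl⟩, fun a ha => ?_⟩
  obtain ⟨w, hw⟩ := T.exists_mem_cell_singleton a
  have := (hg (f w) ⟨w, cell_mono (Finset.singleton_subset_iff.2 ha) hw, rfl⟩).self_of_nhds
  rwa [h.apply_vertex (hrt ha) hw, h'.apply_vertex (hrs ha) hw] at this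

/-- One isometry relates the two embeddings along the common cell. With `s = t` this makes side
lengths independent of the embedding; with adjacent faces it makes them a function of the edge. -/
theorem dist_eq (h : T.IsFaceEmbedding f t φ x) (h' : T.IsFaceEmbedding f s ψ y)
    (ht : t ∈ T.faces) {a b : V} (hat : a ∈ t) (has : a ∈ s) (hbt : b ∈ t) (hbs : b ∈ s) :
    dist (x a) (x b) = dist (y a) (y b) := by
  classical
  obtain ⟨g, -, hg⟩ := h.exists_transition h' ht (Finset.inter_subset_left (s₁ := t) (s₂ := s))
    Finset.inter_subset_right
  rw [hg a (Finset.mem_inter.2 ⟨hat, has⟩), hg b (Finset.mem_inter.2 ⟨hbt, hbs⟩), g.dist_eq]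

/-- Adjacent faces lie on different sides of their common edge. -/
theorem not_hypSide_mul_pos [DecidableEq V] (h : T.IsFaceEmbedding f t φ x)
    (h' : T.IsFaceEmbedding f s ψ y) {a b c d : V} (hab : a ≠ b) (hst : t ∩ s = {a, b})
    (hct : c ∈ t) (hcs : c ∉ s) (hds : d ∈ s) (hdt : d ∉ t)
    {g : UpperHalfPlane ≃ᵢ UpperHalfPlane}
    (hg : ∀ w ∈ T.cell (t ∩ s), ∀ᶠ z in 𝓝 (f w), ψ z = g (φ z))
    (hgx : ∀ a ∈ t ∩ s, y a = g (x a)) :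
    ¬ 0 < hypSide (x a) (x b) (x c) * hypSide (x a) (x b) (g.symm (y d)) := by
  intro hpos
  have ha : a ∈ t ∩ s := by rw [hst]; simp
  have hb : b ∈ t ∩ s := by rw [hst]; simp
  obtain ⟨hat, has⟩ := Finset.mem_inter.1 ha
  obtain ⟨hbt, hbs⟩ := Finset.mem_inter.1 hb
  obtain ⟨w, hw⟩ := T.exists_mem_cell_singleton a
  have hwr : w ∈ T.cell (t ∩ s) := cell_mono (Finset.singleton_subset_iff.2 ha) hw
  have hwφ : f w ∈ φ.source := h.mem_source (cell_mono Finset.inter_subset_left hwr)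
  have hwψ : f w ∈ ψ.source := h'.mem_source (cell_mono Finset.inter_subset_right hwr)
  have hxa : φ (f w) = x a := h.apply_vertex hat hw
  have ht : Tendsto φ.symm (𝓝 (x a)) (𝓝 (f w)) := by
    rw [← hxa]
    exact φ.tendsto_symm hwφ
  have hU : {z | z ∈ φ.target ∧ ψ (φ.symm z) = g (φ (φ.symm z)) ∧ φ.symm z ∈ ψ.source} ∈ 𝓝 (x a) :=
    inter_mem (φ.open_target.mem_nhds (hxa ▸ φ.map_source hwφ))
      (inter_mem (ht.eventually (hg w hwr)) (ht.eventually (ψ.open_source.mem_nhds hwψ)))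
  -- Triangles on the same side would overlap near `a` at a point off the edge, whereas injectivity
  -- of `f` puts every common point into the cell of `t ∩ s`, which is the edge.
  obtain ⟨z, ⟨hz1, hz2, hz3⟩, hzc, hzd, hzn⟩ := exists_mem_hypTriangle_inter hpos hU
  rw [φ.right_inv hz1] at hz2
  have hca : c ≠ a := fun hh => hcs (hh ▸ has)
  have hcb : b ≠ c := fun hh => hcs (hh ▸ hbs)
  have hda : d ≠ a := fun hh => hdt (hh ▸ hat)
  have hdb : b ≠ d := fun hh => hdt (hh ▸ hbt)
  rw [← h.image_face a hat b hbt c hct hab hcb hca] at hzc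
  obtain ⟨_, ⟨q, hq, rfl⟩, hqz⟩ := hzc
  have hzd' := mem_hypTriangle_apply (g := g) hzd
  rw [g.apply_symm_apply, ← hgx a ha, ← hgx b hb,
    ← h'.image_face a has b hbs d hds hab hdb hda, ← hz2] at hzd'
  obtain ⟨_, ⟨q', hq', rfl⟩, hqz'⟩ := hzd'
  have e1 : f q = φ.symm z := by rw [← hqz, φ.left_inv (h.mem_source hq)]
  have e2 : f q' = φ.symm z := ψ.injOn (h'.mem_source hq') hz3 hqz'
  have e3 : q = q' := f.injective (e1.trans e2.symm)
  apply hzn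
  rw [← h.image_edge {a, b} (hst ▸ Finset.inter_subset_left) (Finset.card_pair hab) a (by simp) b
    (by simp) hab, ← hst]
  exact ⟨f q, ⟨q, mem_cell_inter hq (e3 ▸ hq'), rfl⟩, hqz⟩

end IsFaceEmbedding

/-! ### Gluing the congruences of the faces. -/

variable {G' : Type*} [TopologicalSpace G'] [ChartedSpace UpperHalfPlane G']

/-- Face embeddings of two geodesic triangulations, together with isometries of the hyperbolic
plane which match corresponding faces. -/
structure FaceCongruence (T : SurfaceTriangulation V) (f : T.totalSpace ≃ₜ G)
    (f' : T.totalSpace ≃ₜ G') where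
  chart : Finset V → OpenPartialHomeomorph G UpperHalfPlane
  vertex : Finset V → V → UpperHalfPlane
  chart' : Finset V → OpenPartialHomeomorph G' UpperHalfPlane
  vertex' : Finset V → V → UpperHalfPlane
  map : Finset V → UpperHalfPlane ≃ᵢ UpperHalfPlane
  isFaceEmbedding : ∀ t ∈ T.faces, T.IsFaceEmbedding f t (chart t) (vertex t)
  isFaceEmbedding' : ∀ t ∈ T.faces, T.IsFaceEmbedding f' t (chart' t) (vertex' t)
  map_vertex : ∀ t ∈ T.faces, ∀ a ∈ t, map t (vertex t a) = vertex' t a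
  hypSide_ne_zero : ∀ t ∈ T.faces, ∀ a ∈ t, ∀ b ∈ t, ∀ c ∈ t, a ≠ b → b ≠ c → c ≠ a →
    hypSide (vertex t a) (vertex t b) (vertex t c) ≠ 0

namespace FaceCongruence

variable {f' : T.totalSpace ≃ₜ G'} (C : FaceCongruence T f f')

/-- The inverse of a congruence. -/
noncomputable def symm : FaceCongruence T f' f where
  chart := C.chart'
  vertex := C.vertex'
  chart' := C.chart
  vertex' := C.vertex
  map t := (C.map t).symm
  isFaceEmbedding := C.isFaceEmbedding'
  isFaceEmbedding' := C.isFaceEmbedding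
  map_vertex t ht a ha := by rw [← C.map_vertex t ht a ha, IsometryEquiv.symm_apply_apply]
  hypSide_ne_zero t ht a ha b hb c hc hab hbc hca := by
    rw [← C.map_vertex t ht a ha, ← C.map_vertex t ht b hb, ← C.map_vertex t ht c hc]
    refine hypSide_ne_zero_congr (C.hypSide_ne_zero t ht a ha b hb c hc hab hbc hca) ?_ ?_ ?_ <;>
      exact ((C.map t).dist_eq _ _).symm

/-- The isometry between neighbourhoods of corresponding faces. -/
noncomputable def faceMap (t : Finset V) (y : G) : G' := (C.chart' t).symm (C.map t (C.chart t y))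

variable {t s : Finset V}

theorem chart'_image_cell (ht : t ∈ T.faces) {r : Finset V} (hr : r ⊆ t) :
    C.chart' t '' (f' '' T.cell r) = C.map t '' (C.chart t '' (f '' T.cell r)) := by
  classical
  have h := C.isFaceEmbedding t ht
  have h' := C.isFaceEmbedding' t ht
  have hm := C.map_vertex t ht
  have h3 := T.card_face t ht
  have hle := Finset.card_le_card hr
  rw [h3] at hle
  interval_cases hc : r.card
  · rw [Finset.card_eq_zero.1 hc, cell_empty]; simp
  · obtain ⟨a, rfl⟩ := Finset.card_eq_one.1 hc
    have ha := Finset.singleton_subset_iff.1 hr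
    rw [h.image_vertex a ha, h'.image_vertex a ha, Set.image_singleton, hm a ha]
  · obtain ⟨a, b, hab, rfl⟩ := Finset.card_eq_two.1 hc
    have ha : a ∈ t := hr (by simp)
    have hb : b ∈ t := hr (by simp)
    rw [h.image_edge {a, b} hr hc a (by simp) b (by simp) hab,
      h'.image_edge {a, b} hr hc a (by simp) b (by simp) hab, image_hypSegment, hm a ha, hm b hb]
  · obtain rfl := Finset.eq_of_subset_of_card_le hr (by rw [h3, hc])
    obtain ⟨a, b, c, hab, hac, hbc, rfl⟩ := Finset.card_eq_three.1 hc
    have ha : a ∈ ({a, b, c} : Finset V) := by simp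
    have hb : b ∈ ({a, b, c} : Finset V) := by simp
    have hcc : c ∈ ({a, b, c} : Finset V) := by simp
    rw [h.image_face a ha b hb c hcc hab hbc hac.symm,
      h'.image_face a ha b hb c hcc hab hbc hac.symm, image_hypTriangle, hm a ha, hm b hb,
      hm c hcc]

theorem faceMap_image_cell (ht : t ∈ T.faces) {r : Finset V} (hr : r ⊆ t) :
    C.faceMap t '' (f '' T.cell r) = f' '' T.cell r := by
  have e : C.faceMap t '' (f '' T.cell r) =
      (C.chart' t).symm '' (C.map t '' (C.chart t '' (f '' T.cell r))) := by
    simp only [Set.image_image]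
    rfl
  rw [e, ← C.chart'_image_cell ht hr]
  apply (C.chart' t).toPartialEquiv.symm_image_image_of_subset_source
  exact (Set.image_mono (cell_mono hr)).trans (C.isFaceEmbedding' t ht).subset_source

theorem map_chart_mem_target (ht : t ∈ T.faces) {w : T.totalSpace} (hw : w ∈ T.cell t) :
    C.map t (C.chart t (f w)) ∈ (C.chart' t).target := by
  have : C.map t (C.chart t (f w)) ∈ C.map t '' (C.chart t '' (f '' T.cell t)) :=
    ⟨_, ⟨_, ⟨w, hw, rfl⟩, rfl⟩, rfl⟩
  rw [← C.chart'_image_cell ht subset_rfl] at this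
  obtain ⟨_, ⟨q, hq, rfl⟩, hqe⟩ := this
  rw [← hqe]
  exact (C.chart' t).map_source ((C.isFaceEmbedding' t ht).mem_source hq)

theorem tendsto_faceMap (ht : t ∈ T.faces) {w : T.totalSpace} (hw : w ∈ T.cell t) :
    Tendsto (C.faceMap t) (𝓝 (f w)) (𝓝 (C.faceMap t (f w))) :=
  ((C.chart' t).continuousAt_symm (C.map_chart_mem_target ht hw)).tendsto.comp
    ((C.map t).continuous.continuousAt.tendsto.comp
      ((C.chart t).continuousAt ((C.isFaceEmbedding t ht).mem_source hw)).tendsto)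

theorem eventually_chart'_faceMap (ht : t ∈ T.faces) {w : T.totalSpace} (hw : w ∈ T.cell t) :
    ∀ᶠ z in 𝓝 (f w), C.chart' t (C.faceMap t z) = C.map t (C.chart t z) := by
  have : Tendsto (fun z => C.map t (C.chart t z)) (𝓝 (f w)) (𝓝 (C.map t (C.chart t (f w)))) :=
    (C.map t).continuous.continuousAt.tendsto.comp
      ((C.chart t).continuousAt ((C.isFaceEmbedding t ht).mem_source hw)).tendsto
  filter_upwards [this.eventually
    ((C.chart' t).open_target.mem_nhds (C.map_chart_mem_target ht hw))] with z hz
  exact (C.chart' t).right_inv hz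

theorem symm_faceMap_faceMap (ht : t ∈ T.faces) {w : T.totalSpace} (hw : w ∈ T.cell t) :
    C.symm.faceMap t (C.faceMap t (f w)) = f w := by
  change (C.chart t).symm ((C.map t).symm (C.chart' t (C.faceMap t (f w)))) = f w
  rw [(C.eventually_chart'_faceMap ht hw).self_of_nhds, IsometryEquiv.symm_apply_apply,
    (C.chart t).left_inv ((C.isFaceEmbedding t ht).mem_source hw)]

/-- Seen in the charts of `t`, the face map of `s` becomes the isometry `k`, which agrees with
`C.map t` at `a` and `b`. As a third point serves `y`, the apex of `s` unfolded into the chart of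
`t`: its two images have the same distances from the images of `a` and `b`, and both lie opposite to
the image of `c`. -/
theorem eventuallyEq_of_card_inter_eq_two [DecidableEq V] (ht : t ∈ T.faces) (hs : s ∈ T.faces)
    (hcard : (t ∩ s).card = 2) {w : T.totalSpace} (hw : w ∈ T.cell (t ∩ s)) :
    ∀ᶠ z in 𝓝 (f w), C.faceMap t z = C.faceMap s z := by
  obtain ⟨a, b, c, hab, hbc, hca, hst, htc⟩ :=
    exists_eq_insert_of_edge ht Finset.inter_subset_left hcard
  obtain ⟨a', b', d, hab', hbd, hda, hst', hsd⟩ :=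
    exists_eq_insert_of_edge hs Finset.inter_subset_right hcard
  have hc : c ∉ t ∩ s := by rw [hst]; simp [hbc.symm, hca]
  have hd : d ∉ t ∩ s := by rw [hst']; simp [hbd.symm, hda]
  have hct : c ∈ t := by rw [htc]; simp
  have hds : d ∈ s := by rw [hsd]; simp
  have hcs : c ∉ s := fun h => hc (Finset.mem_inter.2 ⟨hct, h⟩)
  have hdt : d ∉ t := fun h => hd (Finset.mem_inter.2 ⟨h, hds⟩)
  have ha : a ∈ t ∩ s := by rw [hst]; simp
  have hb : b ∈ t ∩ s := by rw [hst]; simp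
  obtain ⟨hat, has⟩ := Finset.mem_inter.1 ha
  obtain ⟨hbt, hbs⟩ := Finset.mem_inter.1 hb
  have hbd' : b ≠ d := fun hh => hdt (hh ▸ hbt)
  have hda' : d ≠ a := fun hh => hdt (hh ▸ hat)
  obtain ⟨g, hg, hgx⟩ := (C.isFaceEmbedding t ht).exists_transition (C.isFaceEmbedding s hs) ht
    (Finset.inter_subset_left (s₁ := t) (s₂ := s)) Finset.inter_subset_right
  obtain ⟨g', hg', hgx'⟩ := (C.isFaceEmbedding' t ht).exists_transition (C.isFaceEmbedding' s hs)
    ht (Finset.inter_subset_left (s₁ := t) (s₂ := s)) Finset.inter_subset_right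
  have hn := (C.isFaceEmbedding t ht).not_hypSide_mul_pos (C.isFaceEmbedding s hs) hab hst hct hcs
    hds hdt hg hgx
  have hn' := (C.isFaceEmbedding' t ht).not_hypSide_mul_pos (C.isFaceEmbedding' s hs) hab hst hct
    hcs hds hdt hg' hgx'
  set y := g.symm (C.vertex s d) with hy
  set y' := g'.symm (C.vertex' s d) with hy'
  set k := (g.trans (C.map s)).trans g'.symm with hk
  have hka : k (C.vertex t a) = C.vertex' t a := by
    simp only [hk, IsometryEquiv.trans_apply]
    rw [← hgx a ha, C.map_vertex s hs a has, hgx' a ha, IsometryEquiv.symm_apply_apply]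
  have hkb : k (C.vertex t b) = C.vertex' t b := by
    simp only [hk, IsometryEquiv.trans_apply]
    rw [← hgx b hb, C.map_vertex s hs b hbs, hgx' b hb, IsometryEquiv.symm_apply_apply]
  have hky : k y = y' := by
    simp only [hk, IsometryEquiv.trans_apply]
    rw [hy, IsometryEquiv.apply_symm_apply, C.map_vertex s hs d hds]
  have hma := C.map_vertex t ht a hat
  have hmb := C.map_vertex t ht b hbt
  have hmc := C.map_vertex t ht c hct
  have hside : hypSide (C.vertex t a) (C.vertex t b) y ≠ 0 := by
    refine hypSide_ne_zero_congr
      (C.hypSide_ne_zero s hs a has b hbs d hds hab hbd' hda') ?_ ?_ ?_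
    · rw [hgx a ha, hgx b hb, g.dist_eq]
    · rw [hgx a ha, ← g.dist_eq (C.vertex t a) y, hy, g.apply_symm_apply]
    · rw [hgx b hb, ← g.dist_eq (C.vertex t b) y, hy, g.apply_symm_apply]
  have hsidec := C.hypSide_ne_zero t ht a hat b hbt c hct hab hbc hca
  have hside' : hypSide (C.vertex' t a) (C.vertex' t b) y' ≠ 0 := by
    rw [← hka, ← hkb, ← hky]
    refine hypSide_ne_zero_congr hside ?_ ?_ ?_ <;> exact (k.dist_eq _ _).symm
  have hmy : C.map t y = y' := by
    refine eq_of_dist_eq_of_hypSide_mul_pos (a := C.vertex' t a) (b := C.vertex' t b) ?_ ?_ ?_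
    · rw [← hma, (C.map t).dist_eq, hma, ← hka, ← hky, k.dist_eq]
    · rw [← hmb, (C.map t).dist_eq, hmb, ← hkb, ← hky, k.dist_eq]
    · have e1 := (C.map t).hypSide_mul (C.vertex t a) (C.vertex t b) (C.vertex t c) y
      have hsidec' : hypSide (C.vertex' t a) (C.vertex' t b) (C.vertex' t c) ≠ 0 :=
        C.symm.hypSide_ne_zero t ht a hat b hbt c hct hab hbc hca
      rw [hma, hmb, hmc] at e1
      have e2 := lt_of_le_of_ne (not_lt.1 hn) (mul_ne_zero hsidec hside)
      have e3 := lt_of_le_of_ne (not_lt.1 hn') (mul_ne_zero hsidec' hside')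
      rw [← e1] at e2
      -- Both apexes are opposite to `c`; the product of the two negative quantities is the desired
      -- one times a square.
      have e4 := mul_pos_of_neg_of_neg e2 e3
      set p := hypSide (C.vertex' t a) (C.vertex' t b) (C.vertex' t c)
      have e5 : 0 < p ^ 2 := by positivity
      refine (mul_pos_iff_of_pos_left e5).1 (lt_of_lt_of_eq e4 ?_)
      ring
  have hmk : C.map t = k :=
    IsometryEquiv.ext_of_hypSide_ne_zero hside (hma.trans hka.symm) (hmb.trans hkb.symm)
      (hmy.trans hky.symm)
  have hwt : w ∈ T.cell t := cell_mono Finset.inter_subset_left hw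
  have hws : w ∈ T.cell s := cell_mono Finset.inter_subset_right hw
  obtain ⟨q, hq, hqe⟩ : C.faceMap t (f w) ∈ f' '' T.cell (t ∩ s) := by
    rw [← C.faceMap_image_cell ht Finset.inter_subset_left]
    exact ⟨_, ⟨w, hw, rfl⟩, rfl⟩
  have htend := C.tendsto_faceMap ht hwt
  rw [← hqe] at htend
  filter_upwards [hg w hw, htend.eventually (hg' q hq), C.eventually_chart'_faceMap ht hwt,
    htend.eventually ((C.chart' s).open_source.mem_nhds
      ((C.isFaceEmbedding' s hs).mem_source (cell_mono Finset.inter_subset_right hq)))]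
    with z z1 z2 z3 z4
  rw [z3, hmk] at z2
  simp only [hk, IsometryEquiv.trans_apply, IsometryEquiv.apply_symm_apply] at z2
  rw [← z1] at z2
  rw [← (C.chart' s).left_inv z4, z2]
  rfl

/-- The isometries between neighbourhoods of corresponding faces agree near common points. -/
theorem eventuallyEq_faceMap (ht : t ∈ T.faces) (hs : s ∈ T.faces) {w : T.totalSpace}
    (hwt : w ∈ T.cell t) (hws : w ∈ T.cell s) :
    ∀ᶠ z in 𝓝 (f w), C.faceMap t z = C.faceMap s z := by
  classical
  have adj : ∀ t ∈ T.faces, ∀ s ∈ T.faces, 2 ≤ (t ∩ s).card → w ∈ T.cell (t ∩ s) →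
      ∀ᶠ z in 𝓝 (f w), C.faceMap t z = C.faceMap s z := by
    intro t ht s hs h2 hw
    rcases h2.eq_or_lt with h2 | h3
    · exact C.eventuallyEq_of_card_inter_eq_two ht hs h2.symm hw
    · have e1 : t ∩ s = t :=
        Finset.eq_of_subset_of_card_le Finset.inter_subset_left (by rw [T.card_face t ht]; omega)
      have e2 : t ∩ s = s :=
        Finset.eq_of_subset_of_card_le Finset.inter_subset_right (by rw [T.card_face s hs]; omega)
      rw [← e1.symm.trans e2]
      exact Eventually.of_forall fun _ => rfl
  have hw := mem_cell_inter hwt hws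
  by_cases h2 : 2 ≤ (t ∩ s).card
  · exact adj t ht s hs h2 hw
  -- The faces now meet only in the vertex `v`, so `w` is this vertex, and a chain of adjacent faces
  -- around it joins `t` to `s`.
  obtain ⟨v, hv⟩ := exists_ne_zero w
  have hvts := hw v hv
  have h1 : t ∩ s = {v} := by
    symm
    apply Finset.eq_of_subset_of_card_le (Finset.singleton_subset_iff.2 hvts)
    rw [Finset.card_singleton]; omega
  obtain ⟨hvt, hvs⟩ := Finset.mem_inter.1 hvts
  rw [h1] at hw
  have hchain := T.link_connected v t ht hvt s hs hvs
  have key : s ∈ T.faces ∧ v ∈ s ∧ ∀ᶠ z in 𝓝 (f w), C.faceMap t z = C.faceMap s z := by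
    clear hws hvts h1 h2 hs hvs
    induction hchain with
    | refl => exact ⟨ht, hvt, Eventually.of_forall fun _ => rfl⟩
    | @tail r u _ hru ih =>
      obtain ⟨hr, hvr, hev⟩ := ih
      obtain ⟨hu, e, hec, hve, her, heu⟩ := hru
      refine ⟨hu, heu hve, ?_⟩
      have h2 : 2 ≤ (r ∩ u).card := hec ▸ Finset.card_le_card (Finset.subset_inter her heu)
      have hwru : w ∈ T.cell (r ∩ u) :=
        cell_mono (Finset.singleton_subset_iff.2 (Finset.mem_inter.2 ⟨hvr, heu hve⟩)) hw
      filter_upwards [hev, adj r hr u hu h2 hwru] with z e1 e2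
      rw [e1, e2]
  exact key.2.2

/-- The map which is a congruence on every face. -/
noncomputable def toFun (y : G) : G' := C.faceMap (exists_mem_cell_face (f.symm y)).choose y

/-- The face chosen by `toFun` may jump from point to point. But cells are closed and finite in
number, so near `f w` only faces containing `w` are eligible, and their maps agree there. -/
theorem eventually_toFun_eq (ht : t ∈ T.faces) {w : T.totalSpace} (hw : w ∈ T.cell t) :
    ∀ᶠ z in 𝓝 (f w), C.toFun z = C.faceMap t z := by
  have h1 : ∀ᶠ z in 𝓝 (f w), ∀ s ∈ T.faces, f.symm z ∈ T.cell s → C.faceMap s z = C.faceMap t z := by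
    rw [Finset.eventually_all]
    intro s hs
    by_cases hws : w ∈ T.cell s
    · filter_upwards [C.eventuallyEq_faceMap hs ht hws hw] with z hz _ using hz
    · have hopen : IsOpen (f.symm ⁻¹' (T.cell s)ᶜ) :=
        (isClosed_cell s).isOpen_compl.preimage f.symm.continuous
      filter_upwards [hopen.mem_nhds (by simpa using hws : f w ∈ f.symm ⁻¹' (T.cell s)ᶜ)]
        with z hz hz'
      exact absurd hz' hz
  filter_upwards [h1] with z hz
  have := (exists_mem_cell_face (f.symm z)).choose_spec
  exact hz _ this.1 this.2

theorem toFun_apply (ht : t ∈ T.faces) {w : T.totalSpace} (hw : w ∈ T.cell t) :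
    C.toFun (f w) = C.faceMap t (f w) :=
  (C.eventually_toFun_eq ht hw).self_of_nhds

theorem continuous_toFun : Continuous C.toFun := by
  rw [continuous_iff_continuousAt]
  intro y
  obtain ⟨w, rfl⟩ := f.surjective y
  obtain ⟨t, ht, hw⟩ := exists_mem_cell_face w
  have := C.tendsto_faceMap ht hw
  rw [← C.toFun_apply ht hw] at this
  exact this.congr' (by
    filter_upwards [C.eventually_toFun_eq ht hw] with z hz using hz.symm)

theorem symm_toFun_toFun (y : G) : C.symm.toFun (C.toFun y) = y := by
  obtain ⟨w, rfl⟩ := f.surjective y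
  obtain ⟨t, ht, hw⟩ := exists_mem_cell_face w
  rw [C.toFun_apply ht hw]
  obtain ⟨q, hq, hqe⟩ : C.faceMap t (f w) ∈ f' '' T.cell t := by
    rw [← C.faceMap_image_cell ht subset_rfl]
    exact ⟨_, ⟨w, hw, rfl⟩, rfl⟩
  rw [← hqe, C.symm.toFun_apply ht hq, hqe, C.symm_faceMap_faceMap ht hw]

/-- The homeomorphism which is a congruence on every face. -/
noncomputable def homeomorph : G ≃ₜ G' where
  toFun := C.toFun
  invFun := C.symm.toFun
  left_inv := C.symm_toFun_toFun
  right_inv := C.symm.symm_toFun_toFun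
  continuous_toFun := C.continuous_toFun
  continuous_invFun := C.symm.continuous_toFun

theorem homeomorph_image_cell (ht : t ∈ T.faces) {r : Finset V} (hr : r ⊆ t) :
    C.homeomorph '' (f '' T.cell r) = f' '' T.cell r := by
  rw [← C.faceMap_image_cell ht hr]
  apply Set.image_congr
  rintro _ ⟨w, hw, rfl⟩
  exact C.toFun_apply ht (cell_mono hr hw)

theorem isSurfaceIsometryAt_homeomorph (y : G) : IsSurfaceIsometryAt C.homeomorph y := by
  obtain ⟨w, rfl⟩ := f.surjective y
  obtain ⟨t, ht, hw⟩ := exists_mem_cell_face w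
  have h : C.homeomorph (f w) ∈ f' '' T.cell t := by
    rw [← C.homeomorph_image_cell ht subset_rfl]
    exact ⟨_, ⟨w, hw, rfl⟩, rfl⟩
  refine ⟨C.chart t, (C.isFaceEmbedding t ht).mem_maximalAtlas, C.chart' t,
    (C.isFaceEmbedding' t ht).mem_maximalAtlas, (C.isFaceEmbedding t ht).mem_source hw,
    (C.isFaceEmbedding' t ht).subset_source h, C.map t, ?_⟩
  filter_upwards [C.eventually_toFun_eq ht hw, C.eventually_chart'_faceMap ht hw] with z e1 e2
  rw [← e2, ← e1]
  rfl

end FaceCongruence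

end SurfaceTriangulation

/-! ### Equality of side lengths by summation over faces and edges. -/

namespace SurfaceTriangulation

theorem sum_powersetCard_two_triple {V : Type*} [DecidableEq V] {a b c : V} (hab : a ≠ b)
    (hbc : b ≠ c) (hca : c ≠ a) (F : Finset V → ℝ) :
    ∑ e ∈ Finset.powersetCard 2 {a, b, c}, F e = F {b, c} + F {a, c} + F {a, b} := by
  have e : Finset.powersetCard 2 {a, b, c} = ({{b, c}, {a, c}, {a, b}} : Finset (Finset V)) := by
    symm
    apply Finset.eq_of_subset_of_card_le
    · intro s hs
      simp only [Finset.mem_insert, Finset.mem_singleton] at hs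
      rw [Finset.mem_powersetCard]
      rcases hs with rfl | rfl | rfl
      · exact ⟨by intro v; simp; tauto, Finset.card_pair hbc⟩
      · exact ⟨by intro v; simp; tauto, Finset.card_pair hca.symm⟩
      · exact ⟨by intro v; simp; tauto, Finset.card_pair hab⟩
    · rw [Finset.card_powersetCard, Finset.card_eq_three.2 ⟨a, b, c, hab, hca.symm, hbc, rfl⟩]
      refine (Finset.card_eq_three.2
        ⟨({b, c} : Finset V), {a, c}, {a, b}, ?_, ?_, ?_, rfl⟩).ge
      · intro h
        have : b ∈ ({a, c} : Finset V) := h ▸ by simp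
        simp [hab.symm, hbc] at this
      · intro h
        have : c ∈ ({a, b} : Finset V) := h ▸ by simp
        simp [hca, hbc.symm] at this
      · intro h
        have : c ∈ ({a, b} : Finset V) := h ▸ by simp
        simp [hca, hbc.symm] at this
  rw [e, Finset.sum_insert, Finset.sum_insert, Finset.sum_singleton, add_assoc]
  · intro h
    have : c ∈ ({a, b} : Finset V) := Finset.mem_singleton.1 h ▸ by simp
    simp [hca, hbc.symm] at this
  · intro h
    simp only [Finset.mem_insert, Finset.mem_singleton] at h
    rcases h with h | h
    · have : b ∈ ({a, c} : Finset V) := h ▸ by simp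
      simp [hab.symm, hbc] at this
    · have : c ∈ ({a, b} : Finset V) := h ▸ by simp
      simp [hca, hbc.symm] at this

/-- The logarithm of `sinh` of half of the length of the edge `e`. -/
noncomputable def logLength {V : Type*} (x : V → UpperHalfPlane) (e : Finset V) : ℝ :=
  Real.log (Real.sinh (Metric.diam (x '' e) / 2))

/-- Taking the diameter makes the length a function of the unordered edge. -/
theorem logLength_pair {V : Type*} [DecidableEq V] (x : V → UpperHalfPlane) (a b : V) :
    logLength x {a, b} = Real.log (halfSinh (x a) (x b)) := by
  rw [logLength, Finset.coe_pair, Set.image_pair, Metric.diam_pair, halfSinh]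

theorem exists_faces_of_edge {V : Type*} (T : SurfaceTriangulation V) {t e : Finset V}
    (ht : t ∈ T.faces) (he : e ⊆ t) (hc : e.card = 2) :
    ∃ t₁ t₂, t₁ ≠ t₂ ∧ ∀ s, s ∈ T.faces ∧ e ⊆ s ↔ s = t₁ ∨ s = t₂ := by
  obtain ⟨t₁, t₂, hne, h⟩ := Set.ncard_eq_two.1 (T.edge_two_faces t ht e he hc)
  exact ⟨t₁, t₂, hne, fun s => Set.ext_iff.1 h s⟩

variable {V : Type*} [Fintype V] {T : SurfaceTriangulation V}
variable {G : Type*} [TopologicalSpace G] [ChartedSpace UpperHalfPlane G]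
variable {f : T.totalSpace ≃ₜ G}

/-- The angle may come from another embedding and from the reversed edge; invariance of distances
and the symmetry of `circumAngle` absorb both choices. -/
theorem IsFaceEmbedding.eq_circumAngle [DecidableEq V] {t : Finset V}
    {φ : OpenPartialHomeomorph G UpperHalfPlane} {x : V → UpperHalfPlane}
    (h : T.IsFaceEmbedding f t φ x) (ht : t ∈ T.faces) {a b c : V} (htc : t = {a, b, c}) {θ : ℝ}
    (hθ : T.IsFaceAngle f t {a, b} θ) :
    hypSide (x a) (x b) (x c) ≠ 0 ∧
      θ = circumAngle (halfSinh (x b) (x c)) (halfSinh (x a) (x c)) (halfSinh (x a) (x b)) := by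
  obtain ⟨ψ, y, hy, a', ha', b', hb', hab', c', hc', hce, hang⟩ := hθ
  obtain ⟨hs, he⟩ := hang.eq_circumAngle
  have ha't : a' ∈ t := by
    rw [htc]; simp only [Finset.mem_insert, Finset.mem_singleton] at ha' ⊢; tauto
  have hb't : b' ∈ t := by
    rw [htc]; simp only [Finset.mem_insert, Finset.mem_singleton] at hb' ⊢; tauto
  have d1 := hy.dist_eq h ht ha't ha't hb't hb't
  have d2 := hy.dist_eq h ht ha't ha't hc' hc'
  have d3 := hy.dist_eq h ht hb't hb't hc' hc'
  replace hs := hypSide_ne_zero_congr hs d1 d2 d3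
  rw [halfSinh, halfSinh, halfSinh, d1, d2, d3, ← halfSinh, ← halfSinh, ← halfSinh] at he
  have hcc : c' = c := by
    rw [htc] at hc'
    simp only [Finset.mem_insert, Finset.mem_singleton] at hc' hce
    tauto
  subst hcc
  rw [Finset.mem_insert, Finset.mem_singleton] at ha' hb'
  rcases ha' with rfl | rfl <;> rcases hb' with rfl | rfl
  · exact absurd rfl hab'
  · exact ⟨hs, he⟩
  · refine ⟨hypSide_ne_zero_rotate (hypSide_ne_zero_rotate (hypSide_ne_zero_swap hs)), ?_⟩
    rw [he, circumAngle_swap, halfSinh_comm (x a') (x b')]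
  · exact absurd rfl hab'

theorem IsRealizedBy.exists_isFaceAngle {p : T.Edge → ℝ} (hf : T.IsRealizedBy p f)
    {t e : Finset V} (ht : t ∈ T.faces) (he : e ⊆ t) (hc : e.card = 2) :
    ∃ θ, T.IsFaceAngle f t e θ := by
  obtain ⟨t₁, t₂, hne, h⟩ := T.exists_faces_of_edge ht he hc
  have h1 := (h t₁).2 (Or.inl rfl)
  have h2 := (h t₂).2 (Or.inr rfl)
  obtain ⟨θ₁, θ₂, a1, a2, -⟩ := hf.2 ⟨e, hc, t, ht, he⟩ t₁ h1.1 t₂ h2.1 hne h1.2 h2.2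
  rcases (h t).1 ⟨ht, he⟩ with rfl | rfl
  · exact ⟨θ₁, a1⟩
  · exact ⟨θ₂, a2⟩

theorem IsFaceAngle.unique (hG : T.IsGeodesic f) {t e : Finset V} (ht : t ∈ T.faces) (he : e ⊆ t)
    (hc : e.card = 2) {θ θ' : ℝ} (h : T.IsFaceAngle f t e θ) (h' : T.IsFaceAngle f t e θ') :
    θ = θ' := by
  classical
  obtain ⟨φ, x, hx⟩ := hG t ht
  obtain ⟨a, b, c, -, -, -, rfl, htc⟩ := exists_eq_insert_of_edge ht he hc
  rw [(hx.eq_circumAngle ht htc h).2, (hx.eq_circumAngle ht htc h').2]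

/-- The strict inequality in `IsCircumscribedAngle` makes the very existence of an angle at an edge
exclude collinear vertices. -/
theorem IsRealizedBy.hypSide_ne_zero {p : T.Edge → ℝ} (hf : T.IsRealizedBy p f)
    {t : Finset V} {φ : OpenPartialHomeomorph G UpperHalfPlane} {x : V → UpperHalfPlane}
    (h : T.IsFaceEmbedding f t φ x) (ht : t ∈ T.faces) {a b c : V} (ha : a ∈ t) (hb : b ∈ t)
    (hc : c ∈ t) (hab : a ≠ b) (hbc : b ≠ c) (hca : c ≠ a) :
    hypSide (x a) (x b) (x c) ≠ 0 := by
  classical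
  have htc : t = ({a, b, c} : Finset V) := by
    symm
    apply Finset.eq_of_subset_of_card_le
    · intro v hv
      simp only [Finset.mem_insert, Finset.mem_singleton] at hv
      rcases hv with rfl | rfl | rfl <;> assumption
    · rw [T.card_face t ht, Finset.card_eq_three.2 ⟨a, b, c, hab, hca.symm, hbc, rfl⟩]
  obtain ⟨θ, hθ⟩ := hf.exists_isFaceAngle ht (e := {a, b})
    (by rw [htc]; intro v; simp; tauto) (Finset.card_pair hab)
  exact (h.eq_circumAngle ht htc hθ).1

variable {G' : Type*} [TopologicalSpace G'] [ChartedSpace UpperHalfPlane G']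
variable {f' : T.totalSpace ≃ₜ G'}

/-- The side lengths of corresponding faces of two realizations of `p` are equal. -/
theorem IsRealizedBy.dist_eq [DecidableEq V] {p : T.Edge → ℝ} (hf : T.IsRealizedBy p f)
    (hf' : T.IsRealizedBy p f') {φ : Finset V → OpenPartialHomeomorph G UpperHalfPlane}
    {x : Finset V → V → UpperHalfPlane} {φ' : Finset V → OpenPartialHomeomorph G' UpperHalfPlane}
    {x' : Finset V → V → UpperHalfPlane}
    (h : ∀ t ∈ T.faces, T.IsFaceEmbedding f t (φ t) (x t))
    (h' : ∀ t ∈ T.faces, T.IsFaceEmbedding f' t (φ' t) (x' t)) {t : Finset V} (ht : t ∈ T.faces)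
    {a b c : V} (hab : a ≠ b) (hbc : b ≠ c) (hca : c ≠ a) (htc : t = {a, b, c}) :
    dist (x t a) (x t b) = dist (x' t a) (x' t b) ∧ dist (x t a) (x t c) = dist (x' t a) (x' t c) ∧
      dist (x t b) (x t c) = dist (x' t b) (x' t c) := by
  have hA : ∀ t e, ∃ θ, t ∈ T.faces → e ⊆ t → e.card = 2 → T.IsFaceAngle f t e θ := by
    intro t e
    by_cases hh : t ∈ T.faces ∧ e ⊆ t ∧ e.card = 2
    · obtain ⟨θ, hθ⟩ := hf.exists_isFaceAngle hh.1 hh.2.1 hh.2.2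
      exact ⟨θ, fun _ _ _ => hθ⟩
    · exact ⟨0, fun h1 h2 h3 => absurd ⟨h1, h2, h3⟩ hh⟩
  have hA' : ∀ t e, ∃ θ, t ∈ T.faces → e ⊆ t → e.card = 2 → T.IsFaceAngle f' t e θ := by
    intro t e
    by_cases hh : t ∈ T.faces ∧ e ⊆ t ∧ e.card = 2
    · obtain ⟨θ, hθ⟩ := hf'.exists_isFaceAngle hh.1 hh.2.1 hh.2.2
      exact ⟨θ, fun _ _ _ => hθ⟩
    · exact ⟨0, fun h1 h2 h3 => absurd ⟨h1, h2, h3⟩ hh⟩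
  choose A hA using hA
  choose A' hA' using hA'
  set F : Finset V → Finset V → ℝ := fun t e =>
    (logLength (x t) e - logLength (x' t) e) * (A t e - A' t e) with hF
  -- Regrouped by edges: both faces at an edge carry the same difference of log lengths, and their
  -- angle differences add up to zero.
  have htotal : ∑ t ∈ T.faces, ∑ e ∈ Finset.powersetCard 2 t, F t e = 0 := by
    rw [Finset.sum_comm' (t' := Finset.powersetCard 2 Finset.univ)
      (s' := fun e => T.faces.filter (e ⊆ ·)) (by
        intro t e
        simp only [Finset.mem_powersetCard, Finset.mem_filter, Finset.subset_univ, true_and]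
        tauto)]
    apply Finset.sum_eq_zero
    intro e he
    have hc := (Finset.mem_powersetCard.1 he).2
    rcases (T.faces.filter (e ⊆ ·)).eq_empty_or_nonempty with h0 | ⟨s, hs⟩
    · rw [h0, Finset.sum_empty]
    obtain ⟨hs, hes⟩ := Finset.mem_filter.1 hs
    obtain ⟨t₁, t₂, hne, hiff⟩ := T.exists_faces_of_edge hs hes hc
    have hfilter : T.faces.filter (e ⊆ ·) = {t₁, t₂} := by
      ext u
      rw [Finset.mem_filter, hiff u]
      simp
    obtain ⟨h1, he1⟩ := (hiff t₁).2 (Or.inl rfl)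
    obtain ⟨h2, he2⟩ := (hiff t₂).2 (Or.inr rfl)
    rw [hfilter, Finset.sum_pair hne, hF]
    obtain ⟨θ₁, θ₂, b1, b2, b3⟩ := hf.2 ⟨e, hc, s, hs, hes⟩ t₁ h1 t₂ h2 hne he1 he2
    obtain ⟨θ₁', θ₂', b1', b2', b3'⟩ := hf'.2 ⟨e, hc, s, hs, hes⟩ t₁ h1 t₂ h2 hne he1 he2
    have e1 := IsFaceAngle.unique hf.1 h1 he1 hc (hA t₁ e h1 he1 hc) b1
    have e2 := IsFaceAngle.unique hf.1 h2 he2 hc (hA t₂ e h2 he2 hc) b2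
    have e1' := IsFaceAngle.unique hf'.1 h1 he1 hc (hA' t₁ e h1 he1 hc) b1'
    have e2' := IsFaceAngle.unique hf'.1 h2 he2 hc (hA' t₂ e h2 he2 hc) b2'
    have hsum : A t₁ e + A t₂ e = A' t₁ e + A' t₂ e := by
      rw [e1, e2, e1', e2', ← b3, ← b3']
    obtain ⟨u, v, huv, rfl⟩ := Finset.card_eq_two.1 hc
    have hu1 : u ∈ t₁ := he1 (by simp)
    have hv1 : v ∈ t₁ := he1 (by simp)
    have hu2 : u ∈ t₂ := he2 (by simp)
    have hv2 : v ∈ t₂ := he2 (by simp)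
    have l1 : logLength (x t₁) {u, v} = logLength (x t₂) {u, v} := by
      rw [logLength_pair, logLength_pair, halfSinh, halfSinh,
        (h t₁ h1).dist_eq (h t₂ h2) h1 hu1 hu2 hv1 hv2]
    have l2 : logLength (x' t₁) {u, v} = logLength (x' t₂) {u, v} := by
      rw [logLength_pair, logLength_pair, halfSinh, halfSinh,
        (h' t₁ h1).dist_eq (h' t₂ h2) h1 hu1 hu2 hv1 hv2]
    simp only [l1, l2]
    linear_combination (logLength (x t₂) {u, v} - logLength (x' t₂) {u, v}) * hsum
  have hface : ∀ t ∈ T.faces, ∀ a b c, a ≠ b → b ≠ c → c ≠ a → t = {a, b, c} →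
      IsSideTriple (halfSinh (x t b) (x t c)) (halfSinh (x t a) (x t c))
        (halfSinh (x t a) (x t b)) ∧
      IsSideTriple (halfSinh (x' t b) (x' t c)) (halfSinh (x' t a) (x' t c))
        (halfSinh (x' t a) (x' t b)) ∧
      ∑ e ∈ Finset.powersetCard 2 t, F t e =
        (Real.log (halfSinh (x t b) (x t c)) - Real.log (halfSinh (x' t b) (x' t c))) *
          (circumAngle (halfSinh (x t a) (x t c)) (halfSinh (x t a) (x t b))
            (halfSinh (x t b) (x t c)) -
          circumAngle (halfSinh (x' t a) (x' t c)) (halfSinh (x' t a) (x' t b))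
            (halfSinh (x' t b) (x' t c))) +
        (Real.log (halfSinh (x t a) (x t c)) - Real.log (halfSinh (x' t a) (x' t c))) *
          (circumAngle (halfSinh (x t a) (x t b)) (halfSinh (x t b) (x t c))
            (halfSinh (x t a) (x t c)) -
          circumAngle (halfSinh (x' t a) (x' t b)) (halfSinh (x' t b) (x' t c))
            (halfSinh (x' t a) (x' t c))) +
        (Real.log (halfSinh (x t a) (x t b)) - Real.log (halfSinh (x' t a) (x' t b))) *
          (circumAngle (halfSinh (x t b) (x t c)) (halfSinh (x t a) (x t c))
            (halfSinh (x t a) (x t b)) -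
          circumAngle (halfSinh (x' t b) (x' t c)) (halfSinh (x' t a) (x' t c))
            (halfSinh (x' t a) (x' t b))) := by
    intro t ht a b c hab hbc hca htc
    have r1 : t = {b, c, a} := by rw [htc]; ext; simp; tauto
    have r2 : t = {a, c, b} := by rw [htc]; ext; simp; tauto
    have s1 : ({a, b} : Finset V) ⊆ t := by rw [htc]; intro v; simp; tauto
    have s2 : ({b, c} : Finset V) ⊆ t := by rw [htc]; intro v; simp; tauto
    have s3 : ({a, c} : Finset V) ⊆ t := by rw [htc]; intro v; simp; tauto
    have k1 := (h t ht).eq_circumAngle ht htc (hA t _ ht s1 (Finset.card_pair hab))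
    have k2 := (h t ht).eq_circumAngle ht r1 (hA t _ ht s2 (Finset.card_pair hbc))
    have k3 := (h t ht).eq_circumAngle ht r2 (hA t _ ht s3 (Finset.card_pair hca.symm))
    have k1' := (h' t ht).eq_circumAngle ht htc (hA' t _ ht s1 (Finset.card_pair hab))
    have k2' := (h' t ht).eq_circumAngle ht r1 (hA' t _ ht s2 (Finset.card_pair hbc))
    have k3' := (h' t ht).eq_circumAngle ht r2 (hA' t _ ht s3 (Finset.card_pair hca.symm))
    refine ⟨isSideTriple_of_hypSide_ne_zero k1.1, isSideTriple_of_hypSide_ne_zero k1'.1, ?_⟩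
    have hsum := sum_powersetCard_two_triple hab hbc hca (F t)
    rw [← htc] at hsum
    rw [hsum, hF]
    simp only [logLength_pair, k1.2, k2.2, k3.2, k1'.2, k2'.2, k3'.2]
    rw [halfSinh_comm (x t c) (x t a), halfSinh_comm (x t b) (x t a),
      halfSinh_comm (x t c) (x t b), halfSinh_comm (x' t c) (x' t a),
      halfSinh_comm (x' t b) (x' t a), halfSinh_comm (x' t c) (x' t b),
      circumAngle_swap (halfSinh (x t b) (x t c)) (halfSinh (x t a) (x t b)),
      circumAngle_swap (halfSinh (x' t b) (x' t c)) (halfSinh (x' t a) (x' t b))]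
  have hnonneg : ∀ t ∈ T.faces, 0 ≤ ∑ e ∈ Finset.powersetCard 2 t, F t e := by
    intro t ht
    obtain ⟨a, b, c, hab, hac, hbc, htc⟩ := Finset.card_eq_three.1 (T.card_face t ht)
    obtain ⟨k1, k2, k3⟩ := hface t ht a b c hab hbc hac.symm htc
    rw [k3]
    by_cases heq : halfSinh (x t b) (x t c) = halfSinh (x' t b) (x' t c) ∧
        halfSinh (x t a) (x t c) = halfSinh (x' t a) (x' t c) ∧
        halfSinh (x t a) (x t b) = halfSinh (x' t a) (x' t b)
    · rw [heq.1, heq.2.1, heq.2.2]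
      simp
    · exact (k1.pairing_pos k2 heq).le
  -- Nonnegative terms with sum zero all vanish, and `pairing_pos` is strict unless the sides
  -- coincide.
  have hzero := (Finset.sum_eq_zero_iff_of_nonneg hnonneg).1 htotal t ht
  obtain ⟨k1, k2, k3⟩ := hface t ht a b c hab hbc hca htc
  rw [k3] at hzero
  by_contra hne
  refine (k1.pairing_pos k2 fun heq => hne ?_).ne' hzero
  exact ⟨dist_eq_of_halfSinh_eq heq.2.2, dist_eq_of_halfSinh_eq heq.2.1,
    dist_eq_of_halfSinh_eq heq.1⟩

theorem IsGeodesic.exists_isFaceEmbedding [Nonempty G] (hf : T.IsGeodesic f) :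
    ∃ (φ : Finset V → OpenPartialHomeomorph G UpperHalfPlane) (x : Finset V → V → UpperHalfPlane),
      ∀ t ∈ T.faces, T.IsFaceEmbedding f t (φ t) (x t) := by
  have h : ∀ t, ∃ (φ : OpenPartialHomeomorph G UpperHalfPlane) (x : V → UpperHalfPlane),
      t ∈ T.faces → T.IsFaceEmbedding f t φ x := by
    intro t
    by_cases ht : t ∈ T.faces
    · obtain ⟨φ, x, hx⟩ := hf t ht
      exact ⟨φ, x, fun _ => hx⟩
    -- A default chart outside the faces, which needs a point of `G`.
    · exact ⟨chartAt UpperHalfPlane (Classical.arbitrary G), fun _ => UpperHalfPlane.I,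
        fun h => absurd h ht⟩
  choose φ x h using h
  exact ⟨φ, x, h⟩

theorem IsRealizedBy.nonempty_faceCongruence [Nonempty G] [Nonempty G'] {p : T.Edge → ℝ}
    (hf : T.IsRealizedBy p f) (hf' : T.IsRealizedBy p f') : Nonempty (FaceCongruence T f f') := by
  classical
  obtain ⟨φ, x, h⟩ := hf.1.exists_isFaceEmbedding
  obtain ⟨φ', x', h'⟩ := hf'.1.exists_isFaceEmbedding
  have hm : ∀ t, ∃ m : UpperHalfPlane ≃ᵢ UpperHalfPlane,
      t ∈ T.faces → ∀ a ∈ t, m (x t a) = x' t a := by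
    intro t
    by_cases ht : t ∈ T.faces
    · obtain ⟨a, b, c, hab, hac, hbc, htc⟩ := Finset.card_eq_three.1 (T.card_face t ht)
      obtain ⟨d1, d2, d3⟩ := hf.dist_eq hf' h h' ht hab hbc hac.symm htc
      have hside := hf.hypSide_ne_zero (h t ht) ht (a := a) (b := b) (c := c) (by simp [htc])
        (by simp [htc]) (by simp [htc]) hab hbc hac.symm
      obtain ⟨m, m1, m2, m3⟩ :=
        exists_isometryEquiv_of_dist_eq (ne_of_hypSide_ne_zero hside).1 d1 d2 d3
      refine ⟨m, fun _ v hv => ?_⟩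
      rw [htc, Finset.mem_insert, Finset.mem_insert, Finset.mem_singleton] at hv
      rcases hv with rfl | rfl | rfl <;> assumption
    · exact ⟨IsometryEquiv.refl _, fun h => absurd h ht⟩
  choose m hm using hm
  exact ⟨{ chart := φ, vertex := x, chart' := φ', vertex' := x', map := m, isFaceEmbedding := h
           isFaceEmbedding' := h', map_vertex := hm
           hypSide_ne_zero := fun t ht _ ha _ hb _ hc => hf.hypSide_ne_zero (h t ht) ht ha hb hc }⟩

end SurfaceTriangulation

theorem fact2p1 {V : Type*} [Fintype V] (T : SurfaceTriangulation V) (p : T.Edge → ℝ)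
    {G : Type*} [TopologicalSpace G] [T2Space G] [CompactSpace G]
    [ChartedSpace UpperHalfPlane G] [HasGroupoid G hypGroupoid]
    {G' : Type*} [TopologicalSpace G'] [T2Space G'] [CompactSpace G']
    [ChartedSpace UpperHalfPlane G'] [HasGroupoid G' hypGroupoid]
    (f : T.totalSpace ≃ₜ G) (f' : T.totalSpace ≃ₜ G')
    (hf : T.IsRealizedBy p f) (hf' : T.IsRealizedBy p f') :
    ∃ i : Structomorph hypGroupoid G G',
      ∀ t ∈ T.faces, ∀ s ⊆ t,
        i.toHomeomorph '' (f '' T.cell s) = f' '' T.cell s := by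
  -- An empty surface has no charts at all, since the inverse of a chart would produce a point.
  rcases isEmpty_or_nonempty G with hG | hG
  · have hG' : IsEmpty G' := (f'.symm.trans f).toEquiv.isEmpty
    exact ⟨{ f.symm.trans f' with
      mem_groupoid := fun c _ _ _ => (hG.false (c.symm UpperHalfPlane.I)).elim },
      fun _ _ _ _ => Subsingleton.elim _ _⟩
  · have hG' : Nonempty G' := (f.symm.trans f').toEquiv.nonempty_congr.1 hG
    obtain ⟨C⟩ := hf.nonempty_faceCongruence hf'
    exact ⟨structomorphOfIsSurfaceIsometryAt C.homeomorph C.isSurfaceIsometryAt_homeomorph,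
      fun t ht s hs => C.homeomorph_image_cell ht hs⟩
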